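/- Let $m\ge 2$, let $\Omega\subset\mathbb R^m$ be open, and let $\alpha>0$. For $u\in L^1(\Omega)$ put $$\mathrm{TV}(u)=\sup\Big\{\int_\Omega u\,\operatorname{div}\varphi\,dx \;\Big|\; \varphi\in C_c^\infty(\Omega;\mathbb R^m),\ \|\varphi(x)\|_2\le 1 \text{ for all } x\Big\}\in[0,\infty];$$ this is the total mass $\|Du\|_{\mathcal M(\Omega;\mathbb R^m)}$ of the distributional gradient $Du$ (it is $\infty$ if $Du$ is not a finite measure). We write $u\in \mathrm{BV}(\Omega)$ if $u\in L^1(\Omega)$ and $Du$ is a finite $\mathbb R^m$-valued Borel measure on $\Omega$; $|Du|$ denotes its total variation measure, and $|Du|(A):=|Du|(A\cap\Omega)$ for Borel sets $A\subset\mathbb R^m$. Weak* convergence $u^i\to u$ in $\mathrm{BV}(\Omega)$ means $u^i\to u$ in $L^1(\Omega)$ and $Du^i\to Du$ weakly* as measures. Let $R:L^1(\Omega)\to[0,\infty]$. * $R$ is *admissible* if it is convex, lower semicontinuous with respect to weak* convergence of sequences in $\mathrm{BV}(\Omega)$, and there is $C>0$ with $\|Du\|_{\mathcal M(\Omega;\mathbb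 R^m)}\le C\,(1+\|u\|_{L^1(\Omega)}+R(u))$ for all $u\in L^1(\Omega)$. * For an open set $U\subset\Omega$ let $\mathcal F(\Omega,U)$ be the set of bijections $\gamma:\Omega\to\Omega$ such that $\gamma$ and $\gamma^{-1}$ are Lipschitz and map Lebesgue null sets to Lebesgue null sets, and $\gamma(x)=x$ for $x\in\Omega\setminus U$. Put $\gamma_\#u:=u\circ\gamma^{-1}$. With $\nabla\gamma^{-1}$ the transpose of the derivative of $\gamma^{-1}$, $\mathcal J\gamma=|\det\nabla\gamma|$ and $L_\gamma(x):=\nabla\gamma^{-1}(\gamma(x))\,\mathcal J\gamma(x)$ (all defined for almost every $x\in\Omega$), let $$T(\gamma_1,\gamma_2):=\operatorname*{ess\,sup}_{x\in\Omega}\,\sup_{\|v\|=1}\big(\|L_{\gamma_1}(x)v\|+\|L_{\gamma_2}(x)v\|-2\|v\|\big)+\operatorname*{ess\,sup}_{x\in\Omega}\big|\mathcal J\gamma_1(x)+\mathcal J\gamma_2(x)-2\big|+\sum_{i=1}^2\Big(\operatorname*{ess\,sup}_{x\in\Omega}\big\|\nabla\gamma_i^{-1}(\gamma_i(x))-I\big\|\Big)^2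 .$$ * $R$ is *double-Lipschitz comparable* if there is a constant $R^a\ge0$ such that for all $u\in\mathrm{BV}(\Omega)$, all open $U\subset\Omega$ and all $\gamma_1,\gamma_2\in\mathcal F(\Omega,U)$ with $T(\gamma_1,\gamma_2)<1$, $$R(\gamma_{1\#}u)+R(\gamma_{2\#}u)-2R(u)\le R^a\,T(\gamma_1,\gamma_2)\,|Du|(\overline U).$$ * $R$ is *separably double-Lipschitz comparable* if there are constants $R^a,R^s\ge0$ such that for all such $u$, $U$, $\gamma_1,\gamma_2$ and every Lipschitz $(m-1)$-graph $\Gamma=\{v+f(v)z\mid v\in V\}$ ($z$ a unit vector, $V\subset z^\perp$ relatively open, $f:V\to\mathbb R$ Lipschitz), the functions $\gamma_{1\#}u,\gamma_{2\#}u$ are in $\mathrm{BV}(\Omega)$ and $$R(\gamma_{1\#}u)+R(\gamma_{2\#}u)-2R(u)\le R^a\,T(\gamma_1,\gamma_2)\,|Du|(\overline U\setminus\Gamma)+R^s\big(|D\gamma_{1\#}u|(\gamma_1(\Gamma\cap\Omega))+|D\gamma_{2\#}u|(\gamma_2(\Gamma\cap\Omega))-2|Du|(\Gamma)\big).$$ **Proposition.**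 The functional $R(u)=\alpha\,\mathrm{TV}(u)$ is admissible, double-Lipschitz comparable and separably double-Lipschitz comparable. Moreover, let $\phi:\mathbb R\to[0,\infty]$ be convex and lower semicontinuous with $\phi(0)=0$, and suppose that for some $p\ge1$ and $C_\phi>0$ one has $\phi(x)-\phi(y)\le C_\phi(|x|-|y|)|x|^{p-1}$ for all $x,y\in\mathbb R$. If $f\in L^1(\Omega)$ and $u\in L^1(\Omega)$ is a minimiser of $$v\mapsto\int_\Omega\phi(f(x)-v(x))\,dx+\alpha\,\mathrm{TV}(v)\qquad\text{over } v\in L^1(\Omega),$$ then $\|u\|_{L^\infty(\Omega)}\le\|f\|_{L^\infty(\Omega)}$. -/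

import Mathlib

open Set Filter Topology MeasureTheory
open scoped NNReal ENNReal ContDiff ZeroAtInfty Gradient

noncomputable section

namespace TVReg

/-- `ℝ^m` with the Euclidean norm. -/
abbrev Eu (m : ℕ) : Type := EuclideanSpace ℝ (Fin m)

variable {m : ℕ}

/-! ### Functions of bounded variation

An element of `L¹(Ω)` is represented by a function `u : ℝ^m → ℝ` that is integrable on `Ω`; only its
values on `Ω`, up to null sets, matter. -/

/-- The divergence `∑ i, ∂_i φ_i` of a vector field. -/
def divergence (φ : Eu m → Eu m) (x : Eu m) : ℝ :=
  ∑ i, (fderiv ℝ φ x (EuclideanSpace.single i 1)) i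

/-- The vector fields `φ ∈ C_c^∞(Ω; ℝ^m)` with `‖φ(x)‖₂ ≤ 1` for all `x`. -/
structure IsTestField (Ω : Set (Eu m)) (φ : Eu m → Eu m) : Prop where
  contDiff : ContDiff ℝ ∞ φ
  hasCompactSupport : HasCompactSupport φ
  tsupport_subset : tsupport φ ⊆ Ω
  norm_le_one : ∀ x, ‖φ x‖ ≤ 1

/-- The isotropic total variation
`TV(u) = sup {∫_Ω u div φ | φ ∈ C_c^∞(Ω; ℝ^m), ‖φ‖_∞ ≤ 1} ∈ [0, ∞]`.
It is the total mass `‖Du‖` of the distributional gradient, and it is `∞` if the gradient of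
`u ∈ L¹(Ω)` is not a finite measure. -/
def TV (Ω : Set (Eu m)) (u : Eu m → ℝ) : ℝ≥0∞ :=
  ⨆ (φ : Eu m → Eu m) (_ : IsTestField Ω φ),
    ENNReal.ofReal (∫ x in Ω, u x * divergence φ x)

/-- The finite `ℝ^m`-valued Borel measure `μ` on `Ω` is the distributional gradient `Du`, that is,
`∫_Ω u ∇ψ dx = - ∫_Ω ψ dμ` for all `ψ ∈ C_c^∞(Ω)`.  The total variation measure `|Du|`
is then `μ.variation`. -/
def HasGradientMeasure (Ω : Set (Eu m)) (u : Eu m → ℝ) (μ : VectorMeasure Ω (Eu m)) : Prop :=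
  ∀ ψ : Eu m → ℝ, ContDiff ℝ ∞ ψ → HasCompactSupport ψ → tsupport ψ ⊆ Ω →
    ∫ x in Ω, u x • ∇ ψ x = - ∫ᵛ x : Ω, ψ x ∂•μ

/-- `u ∈ BV(Ω)`. -/
def MemBV (Ω : Set (Eu m)) (u : Eu m → ℝ) : Prop :=
  IntegrableOn u Ω ∧ ∃ μ : VectorMeasure Ω (Eu m), HasGradientMeasure Ω u μ

/-- Weak* convergence in `BV(Ω)`: all functions are in `BV(Ω)`, `u k → u` strongly in `L¹(Ω)`, and
`D(u k) → Du` weakly* in the dual of `C₀(Ω)`. -/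
def WeakStarTendsto (Ω : Set (Eu m)) (u : ℕ → Eu m → ℝ) (v : Eu m → ℝ) : Prop :=
  (∀ k, IntegrableOn (u k) Ω) ∧ IntegrableOn v Ω ∧
  Tendsto (fun k => ∫ x in Ω, |u k x - v x|) atTop (𝓝 0) ∧
  ∃ (μ : ℕ → VectorMeasure Ω (Eu m)) (ν : VectorMeasure Ω (Eu m)),
    (∀ k, HasGradientMeasure Ω (u k) (μ k)) ∧ HasGradientMeasure Ω v ν ∧
    ∀ g : C₀(Ω, ℝ), Tendsto (fun k => ∫ᵛ x : Ω, g x ∂•(μ k)) atTop (𝓝 (∫ᵛ x : Ω, g x ∂•ν))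

/-! ### Admissible regularisation functionals -/

/-- `R` is an admissible regularisation functional on `L¹(Ω)`: it is well defined on `L¹(Ω)`, convex,
(sequentially) lower semicontinuous with respect to weak* convergence in `BV(Ω)`, and
`‖Du‖ ≤ C (1 + ‖u‖₁ + R(u))` on `L¹(Ω)`. -/
structure IsAdmissible (Ω : Set (Eu m)) (R : (Eu m → ℝ) → ℝ≥0∞) : Prop where
  congr_ae : ∀ u v, IntegrableOn u Ω → IntegrableOn v Ω → u =ᵐ[volume.restrict Ω] v → R u = R v
  convex : ∀ u v, IntegrableOn u Ω → IntegrableOn v Ω → ∀ a b : ℝ≥0, a + b = 1 →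
    R (fun x => a * u x + b * v x) ≤ a * R u + b * R v
  lsc : ∀ (u : ℕ → Eu m → ℝ) (v : Eu m → ℝ), WeakStarTendsto Ω u v →
    R v ≤ liminf (fun k => R (u k)) atTop
  coercive : ∃ C : ℝ≥0, 0 < C ∧ ∀ u, IntegrableOn u Ω →
    TV Ω u ≤ C * (1 + (∫⁻ x in Ω, ‖u x‖ₑ) + R u)

/-! ### Lipschitz transformations and double-Lipschitz comparability -/

/-- The class `F(Ω, U)` of bi-Lipschitz bijections `γ : Ω → Ω`, both directions having
the Lusin `N`-property, with `γ(x) = x` for `x ∈ Ω \ U`.  Here `γ.symm` is `γ⁻¹`; the values of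
either map outside `Ω` play no role. -/
structure IsLipTransform (Ω U : Set (Eu m)) (γ : PartialEquiv (Eu m) (Eu m)) : Prop where
  source_eq : γ.source = Ω
  target_eq : γ.target = Ω
  lipschitz : ∃ K : ℝ≥0, LipschitzOnWith K γ Ω
  lipschitz_symm : ∃ K : ℝ≥0, LipschitzOnWith K γ.symm Ω
  lusin : ∀ N ⊆ Ω, volume N = 0 → volume (γ '' N) = 0
  lusin_symm : ∀ N ⊆ Ω, volume N = 0 → volume (γ.symm '' N) = 0
  eq_self : ∀ x ∈ Ω \ U, γ x = x

/-- The pushforward `γ_# u = u ∘ γ⁻¹`. -/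
def pushforward (γ : PartialEquiv (Eu m) (Eu m)) (u : Eu m → ℝ) : Eu m → ℝ := u ∘ γ.symm

/-- The Jacobian `J_m γ(x) = √det(L* L)`, where `L` is the Fréchet derivative of `γ` at `x`. -/
def jacobian (γ : PartialEquiv (Eu m) (Eu m)) (x : Eu m) : ℝ :=
  √(ContinuousLinearMap.adjoint (fderiv ℝ γ x) ∘L fderiv ℝ γ x).det

/-- `∇γ⁻¹(γ(x))`.  Gradients have the components as columns, so this is the adjoint (transpose)
of the Fréchet derivative. -/
def invGrad (γ : PartialEquiv (Eu m) (Eu m)) (x : Eu m) : Eu m →L[ℝ] Eu m :=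
  ContinuousLinearMap.adjoint (fderiv ℝ γ.symm (γ x))

/-- `∇γ⁻¹(γ(x)) J_m γ(x)`. -/
def lipJac (γ : PartialEquiv (Eu m) (Eu m)) (x : Eu m) : Eu m →L[ℝ] Eu m :=
  jacobian γ x • invGrad γ x

/-! The derivatives exist almost everywhere, so the suprema over `x ∈ Ω` are essential suprema.  All
the functions below are bounded on `Ω` when `γ` and `γ⁻¹` are Lipschitz on `Ω`. -/

/-- `ess sup_x sup_{‖v‖ = 1} (‖L₁(x) v‖ + ‖L₂(x) v‖ - 2 ‖v‖)`, with `L_i = lipJac γ_i`. -/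
def biG (Ω : Set (Eu m)) (γ₁ γ₂ : PartialEquiv (Eu m) (Eu m)) : ℝ :=
  essSup (fun x => ⨆ v : Metric.sphere (0 : Eu m) 1,
    (‖lipJac γ₁ x v‖ + ‖lipJac γ₂ x v‖ - 2 * ‖(v : Eu m)‖)) (volume.restrict Ω)

/-- `ess sup_x |J_m γ₁(x) + J_m γ₂(x) - 2|`. -/
def biJ (Ω : Set (Eu m)) (γ₁ γ₂ : PartialEquiv (Eu m) (Eu m)) : ℝ :=
  essSup (fun x => |jacobian γ₁ x + jacobian γ₂ x - 2|) (volume.restrict Ω)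

/-- The distance to the identity `ess sup_x ‖∇γ⁻¹(γ(x)) - I‖`. -/
def distId (Ω : Set (Eu m)) (γ : PartialEquiv (Eu m) (Eu m)) : ℝ :=
  essSup (fun x => ‖invGrad γ x - ContinuousLinearMap.id ℝ (Eu m)‖) (volume.restrict Ω)

/-- The double-Lipschitz comparison constant. -/
def biT (Ω : Set (Eu m)) (γ₁ γ₂ : PartialEquiv (Eu m) (Eu m)) : ℝ :=
  biG Ω γ₁ γ₂ + biJ Ω γ₁ γ₂ + distId Ω γ₁ ^ 2 + distId Ω γ₂ ^ 2

/-- `|Du|(A)`, for `μ = Du` on `Ω` and a Borel set `A ⊆ ℝ^m`; it means `|Du|(A ∩ Ω)`. -/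
def varOn {Ω : Set (Eu m)} (μ : VectorMeasure Ω (Eu m)) (A : Set (Eu m)) : ℝ≥0∞ :=
  μ.variation ((↑) ⁻¹' A)

/-- `R` is double-Lipschitz comparable. -/
def IsDoubleLipschitzComparable (Ω : Set (Eu m)) (R : (Eu m → ℝ) → ℝ≥0∞) : Prop :=
  ∃ Ra : ℝ, 0 ≤ Ra ∧
    ∀ (u : Eu m → ℝ) (Du : VectorMeasure Ω (Eu m)), IntegrableOn u Ω → HasGradientMeasure Ω u Du →
    ∀ U : Set (Eu m), IsOpen U → U ⊆ Ω →
    ∀ γ₁ γ₂ : PartialEquiv (Eu m) (Eu m), IsLipTransform Ω U γ₁ → IsLipTransform Ω U γ₂ →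
      biT Ω γ₁ γ₂ < 1 →
      (R (pushforward γ₁ u) : EReal) + R (pushforward γ₂ u) - 2 * R u
        ≤ (Ra : EReal) * (biT Ω γ₁ γ₂ : ℝ) * varOn Du (closure U)

/-- `Γ` is a Lipschitz `(m-1)`-graph `{v + f(v) z | v ∈ V}` with `z` a unit vector,
`V ⊆ z^⊥` relatively open and `f : V → ℝ` Lipschitz. -/
def IsLipschitzGraph (Γ : Set (Eu m)) : Prop :=
  ∃ z : Eu m, ‖z‖ = 1 ∧ ∃ (V : Set (ℝ ∙ z)ᗮ) (f : (ℝ ∙ z)ᗮ → ℝ), IsOpen V ∧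
    (∃ L : ℝ≥0, LipschitzOnWith L f V) ∧ Γ = (fun v : (ℝ ∙ z)ᗮ => (v : Eu m) + f v • z) '' V

/-- `R` is separably double-Lipschitz comparable.  That the pushforwards `γ_# u` are again in
`BV(Ω)`, so that `|Dγ_# u|` makes sense, is part of the requirement. -/
def IsSeparablyDoubleLipschitzComparable (Ω : Set (Eu m)) (R : (Eu m → ℝ) → ℝ≥0∞) : Prop :=
  ∃ Ra Rs : ℝ, 0 ≤ Ra ∧ 0 ≤ Rs ∧
    ∀ (u : Eu m → ℝ) (Du : VectorMeasure Ω (Eu m)), IntegrableOn u Ω → HasGradientMeasure Ω u Du →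
    ∀ U : Set (Eu m), IsOpen U → U ⊆ Ω →
    ∀ γ₁ γ₂ : PartialEquiv (Eu m) (Eu m), IsLipTransform Ω U γ₁ → IsLipTransform Ω U γ₂ →
      biT Ω γ₁ γ₂ < 1 →
    ∀ Γ : Set (Eu m), IsLipschitzGraph Γ →
    ∃ D₁ D₂ : VectorMeasure Ω (Eu m),
      HasGradientMeasure Ω (pushforward γ₁ u) D₁ ∧ HasGradientMeasure Ω (pushforward γ₂ u) D₂ ∧
      (R (pushforward γ₁ u) : EReal) + R (pushforward γ₂ u) - 2 * R u
        ≤ (Ra : EReal) * (biT Ω γ₁ γ₂ : ℝ) * varOn Du (closure U \ Γ)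
          + (Rs : EReal) * ((varOn D₁ (γ₁ '' (Γ ∩ Ω)) : EReal) + varOn D₂ (γ₂ '' (Γ ∩ Ω))
              - 2 * varOn Du Γ)

/-! ### The regularisation problem -/

/-- `φ(x) - φ(y) ≤ C (|x| - |y|) |x|^(p-1)` for some `C > 0` and all real `x`, `y`. -/
def IsPIncreasing (p : ℝ) (φ : ℝ → ℝ≥0∞) : Prop :=
  ∃ C : ℝ, 0 < C ∧ ∀ x y : ℝ,
    (φ x : EReal) ≤ φ y + ((C * (|x| - |y|) * |x| ^ (p - 1) : ℝ) : EReal)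

/-- `u ∈ L¹(Ω)` minimises `∫_Ω φ(f - u) dx + R(u)` over `L¹(Ω)`. -/
def IsSolution (Ω : Set (Eu m)) (φ : ℝ → ℝ≥0∞) (R : (Eu m → ℝ) → ℝ≥0∞) (f u : Eu m → ℝ) : Prop :=
  IntegrableOn u Ω ∧ ∀ v : Eu m → ℝ, IntegrableOn v Ω →
    (∫⁻ x in Ω, φ (f x - u x)) + R u ≤ (∫⁻ x in Ω, φ (f x - v x)) + R v

end TVReg

end

/-!
By the Piola identity, a bi-Lipschitz change of variables `γ` turns a test field `φ` for `u ∘ γ⁻¹`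
into the field `x ↦ L_γ(x)* φ(γ(x))` for `u`, whose distributional divergence is `𝒥γ · (div φ) ∘ γ`.
Adding the fields obtained from `γ₁` and `γ₂` and mollifying gives a competitor of norm at most
`2 + T(γ₁, γ₂)`, so on every open `A ⊆ Ω` the variations of the two push-forwards on `γ₁(A)` and
`γ₂(A)` add up to at most `2 + T(γ₁, γ₂)` times the variation of `u` on `A`. On open sets `|Du|` is
the supremum over test fields, and by outer regularity the comparison passes to Borel sets such as
`closure U ∩ Γ` and `closure U \ Γ`; away from `closure U` nothing moves. That `D(u ∘ γ⁻¹)` exists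
follows by duality: `φ ↦ ∫ (u ∘ γ⁻¹) div φ` is bounded in the `L¹` norm, hence in the `L²` norm, of
a multiple of the image of `|Du|` under `γ`, so the Riesz representation theorem supplies a density.

For the maximum principle, truncating `u` at height `M = ‖f‖_∞` does not increase the total
variation, and it strictly decreases the fidelity term unless `|u| ≤ M` almost everywhere.
-/

noncomputable section

namespace TVReg

variable {m : ℕ}

/-! ### Divergence and integration by parts -/

lemma map_eq_sum_single (L : Eu m →L[ℝ] ℝ) (v : Eu m) :
    L v = ∑ i, v i * L (EuclideanSpace.single i 1) := by
  conv_lhs => rw [← (EuclideanSpace.basisFun (Fin m) ℝ).sum_repr v]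
  simp

/-- The trace of an endomorphism of `ℝ^m`, as a continuous linear functional.  The divergence of a
field is the trace of its derivative. -/
def traceCLM (m : ℕ) : (Eu m →L[ℝ] Eu m) →L[ℝ] ℝ :=
  ∑ i, (EuclideanSpace.proj i).comp (ContinuousLinearMap.apply ℝ (Eu m) (EuclideanSpace.single i 1))

lemma traceCLM_fderiv (φ : Eu m → Eu m) (x : Eu m) :
    traceCLM m (fderiv ℝ φ x) = divergence φ x := by
  simp [traceCLM, divergence]

lemma traceCLM_smulRight (L : Eu m →L[ℝ] ℝ) (v : Eu m) : traceCLM m (L.smulRight v) = L v := by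
  simp [traceCLM, map_eq_sum_single L v, mul_comm]

lemma continuous_divergence {φ : Eu m → Eu m} (hφ : ContDiff ℝ 1 φ) :
    Continuous (divergence φ) :=
  ((traceCLM m).continuous.comp (hφ.continuous_fderiv one_ne_zero)).congr (traceCLM_fderiv φ)

lemma support_divergence_subset (φ : Eu m → Eu m) :
    Function.support (divergence φ) ⊆ tsupport φ := by
  refine fun x hx => by_contra fun hφ => hx ?_
  rw [← traceCLM_fderiv, Function.notMem_support.1 fun h => hφ (support_fderiv_subset ℝ h),
    map_zero]

lemma divergence_eq_zero {φ : Eu m → Eu m} {x : Eu m} (hx : x ∉ tsupport φ) :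
    divergence φ x = 0 :=
  Function.notMem_support.1 fun h => hx (support_divergence_subset φ h)

lemma hasCompactSupport_divergence {φ : Eu m → Eu m} (hφ : HasCompactSupport φ) :
    HasCompactSupport (divergence φ) :=
  hφ.mono' (support_divergence_subset φ)

lemma exists_bound_divergence {φ : Eu m → Eu m} (hφ : ContDiff ℝ 1 φ) (hc : HasCompactSupport φ) :
    ∃ C, ∀ x, ‖divergence φ x‖ ≤ C :=
  (hasCompactSupport_divergence hc).exists_bound_of_continuous (continuous_divergence hφ)

@[simp]
lemma divergence_zero (x : Eu m) : divergence (0 : Eu m → Eu m) x = 0 := by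
  simp [divergence]

lemma divergence_const_smul (c : ℝ) (φ : Eu m → Eu m) (x : Eu m) :
    divergence (c • φ) x = c * divergence φ x := by
  simp [← traceCLM_fderiv, fderiv_const_smul_field]

lemma divergence_add {φ χ : Eu m → Eu m} {x : Eu m} (hφ : DifferentiableAt ℝ φ x)
    (hχ : DifferentiableAt ℝ χ x) : divergence (φ + χ) x = divergence φ x + divergence χ x := by
  simp [← traceCLM_fderiv, fderiv_add hφ hχ]

lemma divergence_smul_const {ψ : Eu m → ℝ} {x : Eu m} (hψ : DifferentiableAt ℝ ψ x) (e : Eu m) :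
    divergence (fun y => ψ y • e) x = fderiv ℝ ψ x e := by
  rw [← traceCLM_fderiv, (hψ.hasFDerivAt.smul_const e).fderiv, traceCLM_smulRight]

lemma fderiv_apply_coord {φ : Eu m → Eu m} {x : Eu m} (hφ : DifferentiableAt ℝ φ x) (i : Fin m)
    (v : Eu m) : fderiv ℝ (fun y => φ y i) x v = (fderiv ℝ φ x v) i := by
  have h : HasFDerivAt (fun y => φ y i)
      ((EuclideanSpace.proj (𝕜 := ℝ) i).comp (fderiv ℝ φ x)) x :=
    (EuclideanSpace.proj (𝕜 := ℝ) i).hasFDerivAt.comp x hφ.hasFDerivAt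
  simp [h.fderiv]

section IntegrationByParts

variable {E : Type*} [NormedAddCommGroup E] [NormedSpace ℝ E] [MeasurableSpace E] [BorelSpace E]
  {μ : Measure E} {w ψ : E → ℝ} {K : ℝ≥0}

lemma integrable_fderiv_apply_mul (hw : LipschitzWith K w) (hψ : Integrable ψ μ) (v : E) :
    Integrable (fun x => fderiv ℝ w x v * ψ x) μ :=
  hψ.bdd_mul (c := K * ‖v‖) (measurable_fderiv_apply_const ℝ w v).aestronglyMeasurable
    (.of_forall fun x => (fderiv ℝ w x).le_of_opNorm_le (norm_fderiv_le_of_lipschitz ℝ hw) v)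

lemma integral_mul_fderiv_eq_neg [FiniteDimensional ℝ E] [μ.IsAddHaarMeasure]
    (hw : LipschitzWith K w) (hψ : ContDiff ℝ 1 ψ) (hc : HasCompactSupport ψ) (v : E) :
    ∫ x, w x * fderiv ℝ ψ x v ∂μ = -∫ x, fderiv ℝ w x v * ψ x ∂μ := by
  obtain ⟨D, hD⟩ := hψ.lipschitzWith_of_hasCompactSupport hc one_ne_zero
  calc ∫ x, w x * fderiv ℝ ψ x v ∂μ
      = ∫ x, lineDeriv ℝ ψ x v * w x ∂μ := by
        congr 1 with x
        rw [((hψ.differentiable one_ne_zero) x).lineDeriv_eq_fderiv, mul_comm]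
    _ = -∫ x, lineDeriv ℝ w x v * ψ x ∂μ := by
        simp [hw.integral_lineDeriv_mul_eq hD hc, lineDeriv_neg, integral_neg]
    _ = -∫ x, fderiv ℝ w x v * ψ x ∂μ := by
        congr 1
        refine integral_congr_ae ?_
        filter_upwards [hw.ae_differentiableAt] with x hx
        rw [hx.lineDeriv_eq_fderiv]

end IntegrationByParts

lemma integral_mul_divergence_eq_neg {w : Eu m → ℝ} {K : ℝ≥0} (hw : LipschitzWith K w)
    {φ : Eu m → Eu m} (hφ : ContDiff ℝ 1 φ) (hc : HasCompactSupport φ) :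
    ∫ x, w x * divergence φ x = -∫ x, fderiv ℝ w x (φ x) := by
  have hcoord (i) : ContDiff ℝ 1 (fun x => φ x i) :=
    (EuclideanSpace.proj (𝕜 := ℝ) i).contDiff.comp hφ
  have hcs (i) : HasCompactSupport (fun x => φ x i) := hc.comp_left (g := fun v : Eu m => v i) rfl
  have hdiv (x) : w x * divergence φ x
      = ∑ i, w x * fderiv ℝ (fun y => φ y i) x (EuclideanSpace.single i 1) := by
    simp only [divergence, Finset.mul_sum, fderiv_apply_coord (hφ.differentiable one_ne_zero x)]
  have hint (i) : Integrable
      (fun x => w x * fderiv ℝ (fun y => φ y i) x (EuclideanSpace.single i 1)) := by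
    have hcont : Continuous (fderiv ℝ fun y => φ y i) := (hcoord i).continuous_fderiv one_ne_zero
    exact (hw.continuous.mul (hcont.clm_apply continuous_const)).integrable_of_hasCompactSupport
      ((hcs i).fderiv_apply ℝ _).mul_left
  have hint' (i) : Integrable (fun x => fderiv ℝ w x (EuclideanSpace.single i 1) * φ x i) :=
    integrable_fderiv_apply_mul hw
      ((hcoord i).continuous.integrable_of_hasCompactSupport (hcs i)) _
  simp only [hdiv, map_eq_sum_single (fderiv ℝ w _) (φ _), mul_comm (φ _ _)]
  rw [integral_finsetSum _ fun i _ => hint i, integral_finsetSum _ fun i _ => hint' i,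
    ← Finset.sum_neg_distrib]
  exact Finset.sum_congr rfl fun i _ => integral_mul_fderiv_eq_neg hw (hcoord i) (hcs i) _

/-! ### Elementary properties of the total variation -/

lemma isTestField_zero (Ω : Set (Eu m)) : IsTestField Ω 0 where
  contDiff := contDiff_const
  hasCompactSupport := HasCompactSupport.zero
  tsupport_subset := by simp [tsupport]
  norm_le_one := by simp

lemma integrable_mul_divergence {μ : Measure (Eu m)} {u : Eu m → ℝ}
    (hu : Integrable u μ) {φ : Eu m → Eu m} (hφ : ContDiff ℝ 1 φ) (hc : HasCompactSupport φ) :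
    Integrable (fun x => u x * divergence φ x) μ := by
  obtain ⟨C, hC⟩ := exists_bound_divergence hφ hc
  exact hu.mul_bdd (c := C) (continuous_divergence hφ).aestronglyMeasurable (.of_forall hC)

lemma IsTestField.contDiff_one {Ω : Set (Eu m)} {φ : Eu m → Eu m} (hφ : IsTestField Ω φ) :
    ContDiff ℝ 1 φ :=
  hφ.contDiff.of_le (by simp)

lemma le_TV {Ω : Set (Eu m)} (u : Eu m → ℝ) {φ : Eu m → Eu m} (hφ : IsTestField Ω φ) :
    ENNReal.ofReal (∫ x in Ω, u x * divergence φ x) ≤ TV Ω u :=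
  le_iSup₂ (f := fun (φ : Eu m → Eu m) (_ : IsTestField Ω φ) =>
    ENNReal.ofReal (∫ x in Ω, u x * divergence φ x)) φ hφ

lemma ofReal_integral_le_mul_TV {Ω : Set (Eu m)} (u : Eu m → ℝ) {φ : Eu m → Eu m} {c : ℝ}
    (hφ : ContDiff ℝ ∞ φ) (hcs : HasCompactSupport φ) (hs : tsupport φ ⊆ Ω)
    (hc : ∀ x, ‖φ x‖ ≤ c) :
    ENNReal.ofReal (∫ x in Ω, u x * divergence φ x) ≤ ENNReal.ofReal c * TV Ω u := by
  have hc0 : 0 ≤ c := (norm_nonneg _).trans (hc 0)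
  rcases hc0.eq_or_lt with rfl | hpos
  · obtain rfl : φ = 0 := funext fun x => norm_le_zero_iff.1 (hc x)
    simp
  · have ht : IsTestField Ω (c⁻¹ • φ) := by
      refine ⟨hφ.const_smul c⁻¹, hcs.smul_left (f := fun _ => c⁻¹),
        (closure_mono (Function.support_const_smul_subset c⁻¹ φ)).trans hs, fun x => ?_⟩
      rw [Pi.smul_apply, norm_smul, norm_inv, Real.norm_of_nonneg hc0, inv_mul_le_one₀ hpos]
      exact hc x
    calc ENNReal.ofReal (∫ x in Ω, u x * divergence φ x)
        = ENNReal.ofReal c * ENNReal.ofReal (∫ x in Ω, u x * divergence (c⁻¹ • φ) x) := by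
          rw [← ENNReal.ofReal_mul hc0, ← integral_const_mul]
          congr 2 with x
          rw [divergence_const_smul]
          field_simp
      _ ≤ ENNReal.ofReal c * TV Ω u := by gcongr; exact le_TV u ht

lemma exists_isTestField_max_eq {Ω : Set (Eu m)} (u : Eu m → ℝ) {φ : Eu m → Eu m}
    (hφ : IsTestField Ω φ) : ∃ χ, IsTestField Ω χ ∧
      ∫ x in Ω, u x * divergence χ x = max (∫ x in Ω, u x * divergence φ x) 0 := by
  rcases le_total 0 (∫ x in Ω, u x * divergence φ x) with h | h
  · exact ⟨φ, hφ, (max_eq_left h).symm⟩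
  · exact ⟨0, isTestField_zero Ω, by simp [max_eq_right h]⟩

lemma TV_add_TV_le {A B : Set (Eu m)} {u v : Eu m → ℝ} {c : ℝ≥0∞}
    (h : ∀ φ χ, IsTestField A φ → IsTestField B χ → ENNReal.ofReal
      ((∫ x in A, u x * divergence φ x) + ∫ x in B, v x * divergence χ x) ≤ c) :
    TV A u + TV B v ≤ c := by
  refine ENNReal.biSup_add_biSup_le' ⟨_, isTestField_zero _⟩ ⟨_, isTestField_zero _⟩
    fun φ hφ χ hχ => ?_
  obtain ⟨φ', hφ', hφe⟩ := exists_isTestField_max_eq u hφ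
  obtain ⟨χ', hχ', hχe⟩ := exists_isTestField_max_eq v hχ
  refine le_trans (le_of_eq ?_) (h φ' χ' hφ' hχ')
  rw [hφe, hχe, ENNReal.ofReal_add (le_max_right _ _) (le_max_right _ _)]
  simp [ENNReal.ofReal_max]

lemma TV_congr_ae {Ω : Set (Eu m)} {u v : Eu m → ℝ} (h : u =ᵐ[volume.restrict Ω] v) :
    TV Ω u = TV Ω v := by
  unfold TV
  congr! 4
  exact integral_congr_ae (h.mono fun x hx => by simp only [hx])

lemma TV_add_le {Ω : Set (Eu m)} {u v : Eu m → ℝ} (hu : IntegrableOn u Ω) (hv : IntegrableOn v Ω)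
    (a b : ℝ≥0) : TV Ω (fun x => a * u x + b * v x) ≤ a * TV Ω u + b * TV Ω v := by
  refine iSup₂_le fun φ hφ => ?_
  have hint {w : Eu m → ℝ} (hw : IntegrableOn w Ω) (c : ℝ) :
      Integrable (fun x => c * (w x * divergence φ x)) (volume.restrict Ω) :=
    (integrable_mul_divergence hw hφ.contDiff_one hφ.hasCompactSupport).const_mul c
  calc ENNReal.ofReal (∫ x in Ω, (a * u x + b * v x) * divergence φ x)
      = ENNReal.ofReal
          (a * (∫ x in Ω, u x * divergence φ x) + b * ∫ x in Ω, v x * divergence φ x) := by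
        rw [← integral_const_mul, ← integral_const_mul, ← integral_add (hint hu a) (hint hv b)]
        simp only [add_mul, mul_assoc]
    _ ≤ a * ENNReal.ofReal (∫ x in Ω, u x * divergence φ x)
          + b * ENNReal.ofReal (∫ x in Ω, v x * divergence φ x) := by
        refine ENNReal.ofReal_add_le.trans_eq ?_
        simp [ENNReal.ofReal_mul]
    _ ≤ a * TV Ω u + b * TV Ω v := by gcongr <;> exact le_TV _ hφ

lemma TV_le_liminf {Ω : Set (Eu m)} {u : ℕ → Eu m → ℝ} {v : Eu m → ℝ}
    (hu : ∀ k, IntegrableOn (u k) Ω) (hv : IntegrableOn v Ω)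
    (h : Tendsto (fun k => ∫ x in Ω, |u k x - v x|) atTop (𝓝 0)) :
    TV Ω v ≤ liminf (fun k => TV Ω (u k)) atTop := by
  refine iSup₂_le fun φ hφ => ?_
  have hint {w : Eu m → ℝ} (hw : IntegrableOn w Ω) :=
    integrable_mul_divergence hw hφ.contDiff_one hφ.hasCompactSupport
  obtain ⟨C, hC⟩ := exists_bound_divergence hφ.contDiff_one hφ.hasCompactSupport
  have hlim : Tendsto (fun k => ∫ x in Ω, u k x * divergence φ x) atTop
      (𝓝 (∫ x in Ω, v x * divergence φ x)) := by
    rw [tendsto_iff_norm_sub_tendsto_zero]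
    refine squeeze_zero (fun _ => norm_nonneg _) (fun k => ?_) (by simpa using h.const_mul C)
    rw [← integral_sub (hint (hu k)) (hint hv), ← integral_const_mul]
    refine norm_integral_le_of_norm_le (((hu k).sub hv).abs.const_mul C) (.of_forall fun x => ?_)
    rw [← sub_mul, norm_mul, mul_comm, Real.norm_eq_abs (u k x - v x)]
    gcongr
    exact hC x
  rw [← ((ENNReal.continuous_ofReal.tendsto _).comp hlim).liminf_eq]
  exact liminf_le_liminf (.of_forall fun k => le_TV (u k) hφ)

theorem isAdmissible_TV (Ω : Set (Eu m)) {α : ℝ} (hα : 0 < α) :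
    IsAdmissible Ω (fun u => ENNReal.ofReal α * TV Ω u) where
  congr_ae u v _ _ h := by simp only [TV_congr_ae h]
  convex u v hu hv a b _ := (mul_le_mul_right (TV_add_le hu hv a b) _).trans_eq (by ring)
  lsc u v h := by
    obtain ⟨hu, hv, hlim, -⟩ := h
    rw [ENNReal.liminf_const_mul_of_ne_zero_of_ne_top (by simpa using hα) ENNReal.ofReal_ne_top]
    exact mul_le_mul_right (TV_le_liminf hu hv hlim) _
  coercive := by
    refine ⟨Real.toNNReal α⁻¹, by simpa using hα, fun u _ => ?_⟩
    have h : (Real.toNNReal α⁻¹ : ℝ≥0∞) * ENNReal.ofReal α = 1 := by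
      rw [← ENNReal.ofReal, ← ENNReal.ofReal_mul (by positivity), inv_mul_cancel₀ hα.ne',
        ENNReal.ofReal_one]
    calc TV Ω u = Real.toNNReal α⁻¹ * (ENNReal.ofReal α * TV Ω u) := by rw [← mul_assoc, h, one_mul]
      _ ≤ _ := by
          gcongr
          exact le_add_self

/-! ### Mollification -/

section Mollification

/-- A sequence of smooth bumps at the origin whose supports shrink to the origin. -/
def mollifierBump (E : Type*) [NormedAddCommGroup E] (k : ℕ) : ContDiffBump (0 : E) where
  rIn := 1 / (k + 1) / 2
  rOut := 1 / (k + 1)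
  rIn_pos := by positivity
  rIn_lt_rOut := half_lt_self (by positivity)

lemma tendsto_mollifierBump_rOut (E : Type*) [NormedAddCommGroup E] :
    Tendsto (fun k => (mollifierBump E k).rOut) atTop (𝓝 0) :=
  tendsto_one_div_add_atTop_nhds_zero_nat

variable {E F : Type*} [NormedAddCommGroup E]

lemma eventually_cthickening_subset {K A : Set E} (hK : IsCompact K) (hA : IsOpen A)
    (hKA : K ⊆ A) : ∀ᶠ k : ℕ in atTop, Metric.cthickening (1 / (k + 1)) K ⊆ A := by
  obtain ⟨δ, hδ, h⟩ := hK.exists_cthickening_subset_open hA hKA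
  filter_upwards [tendsto_one_div_add_atTop_nhds_zero_nat.eventually_lt_const hδ] with k hk
  exact (Metric.cthickening_mono hk.le K).trans h

variable [NormedSpace ℝ E] [FiniteDimensional ℝ E] [MeasureSpace E]

variable (E) in
/-- The mollifying kernels, of integral one and supported in the balls of radius `1 / (k + 1)`. -/
def mollifier (k : ℕ) : E → ℝ :=
  (mollifierBump E k).normed volume

lemma contDiff_mollifier (k : ℕ) {n : ℕ∞} : ContDiff ℝ n (mollifier E k) :=
  (mollifierBump E k).contDiff_normed

lemma mollifier_nonneg (k : ℕ) (x : E) : 0 ≤ mollifier E k x :=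
  (mollifierBump E k).nonneg_normed x

lemma mollifier_neg (k : ℕ) (x : E) : mollifier E k (-x) = mollifier E k x :=
  (mollifierBump E k).normed_neg x

lemma contDiff_mollifier_sub (k : ℕ) (x : E) {n : ℕ∞} :
    ContDiff ℝ n (fun t => mollifier E k (x - t)) :=
  (contDiff_mollifier k).comp (contDiff_const.sub contDiff_id)

lemma fderiv_mollifier_sub (k : ℕ) (x t : E) :
    fderiv ℝ (fun s => mollifier E k (x - s)) t = -fderiv ℝ (mollifier E k) (x - t) :=
  (((contDiff_mollifier (n := 1) k).differentiable one_ne_zero (x - t)).hasFDerivAt.comp t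
    ((hasFDerivAt_id t).const_sub x)).fderiv.trans (by ext; simp)

lemma fderiv_mollifier_neg (k : ℕ) (x : E) :
    fderiv ℝ (mollifier E k) (-x) = -fderiv ℝ (mollifier E k) x := by
  simpa [mollifier_neg, neg_eq_iff_eq_neg] using (fderiv_mollifier_sub k 0 x).symm

variable [BorelSpace E] [(volume : Measure E).IsAddHaarMeasure] [NormedAddCommGroup F]
  [NormedSpace ℝ F]

lemma hasCompactSupport_mollifier (k : ℕ) : HasCompactSupport (mollifier E k) :=
  (mollifierBump E k).hasCompactSupport_normed

lemma exists_lipschitzWith_mollifier (k : ℕ) : ∃ L, LipschitzWith L (mollifier E k) :=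
  (contDiff_mollifier k (n := 1)).lipschitzWith_of_hasCompactSupport
    (hasCompactSupport_mollifier k) one_ne_zero

lemma support_mollifier (k : ℕ) :
    Function.support (mollifier E k) = Metric.ball 0 (1 / (k + 1)) :=
  (mollifierBump E k).support_normed_eq

lemma integral_mollifier_sub (k : ℕ) (x : E) : ∫ t, mollifier E k (x - t) = 1 := by
  rw [integral_sub_left_eq_self]
  exact (mollifierBump E k).integral_normed

lemma hasCompactSupport_mollifier_sub (k : ℕ) (x : E) :
    HasCompactSupport (fun t => mollifier E k (x - t)) :=
  (hasCompactSupport_mollifier k).comp_homeomorph (Homeomorph.subLeft x)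

/-- The mollification of `f` with the kernel `mollifier E k`. -/
def mollify (k : ℕ) (f : E → F) : E → F :=
  convolution (mollifier E k) f (ContinuousLinearMap.lsmul ℝ ℝ) volume

lemma mollify_apply (k : ℕ) (f : E → F) (x : E) :
    mollify k f x = ∫ t, mollifier E k (x - t) • f t := by
  simp [mollify, convolution_eq_swap]

lemma integrable_mollifier_smul (k : ℕ) {f : E → F} (hf : LocallyIntegrable f) (x : E) :
    Integrable (fun t => mollifier E k (x - t) • f t) :=
  hf.integrable_smul_left_of_hasCompactSupport
    (contDiff_mollifier_sub (n := 0) k x).continuous (hasCompactSupport_mollifier_sub k x)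

lemma contDiff_mollify [CompleteSpace F] (k : ℕ) {f : E → F} (hf : LocallyIntegrable f) {n : ℕ∞} :
    ContDiff ℝ n (mollify k f) :=
  (hasCompactSupport_mollifier k).contDiff_convolution_left _ (contDiff_mollifier k) hf

lemma fderiv_mollify [CompleteSpace F] (k : ℕ) {f : E → F} (hf : LocallyIntegrable f) (x : E) :
    fderiv ℝ (mollify k f) x = ∫ t, (fderiv ℝ (mollifier E k) (x - t)).smulRight (f t) := by
  rw [mollify, ((hasCompactSupport_mollifier k).hasFDerivAt_convolution_left
    (ContinuousLinearMap.lsmul ℝ ℝ) (contDiff_mollifier k (n := 1)) hf x).fderiv,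
    convolution_eq_swap]
  rfl

lemma integrable_fderiv_mollifier_smulRight (k : ℕ) {f : E → F} (hf : LocallyIntegrable f) (x : E) :
    Integrable (fun t => (fderiv ℝ (mollifier E k) (x - t)).smulRight (f t)) :=
  (((hasCompactSupport_mollifier k).fderiv ℝ).convolutionExists_left
    ((ContinuousLinearMap.lsmul ℝ ℝ).precompL E : (E →L[ℝ] ℝ) →L[ℝ] F →L[ℝ] E →L[ℝ] F)
    ((contDiff_mollifier k (n := 1)).continuous_fderiv one_ne_zero) hf x).integrable_swap

lemma exists_lipschitzWith_mollify (k : ℕ) {f : E → F} (hf : Integrable f) :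
    ∃ L, LipschitzWith L (mollify k f) := by
  obtain ⟨L, hL⟩ := exists_lipschitzWith_mollifier (E := E) k
  refine ⟨Real.toNNReal (L * ∫ t, ‖f t‖), .of_dist_le' fun x y => ?_⟩
  rw [dist_eq_norm, mollify_apply, mollify_apply,
    ← integral_sub (integrable_mollifier_smul k hf.locallyIntegrable x)
      (integrable_mollifier_smul k hf.locallyIntegrable y)]
  calc ‖∫ t, mollifier E k (x - t) • f t - mollifier E k (y - t) • f t‖
      ≤ ∫ t, L * dist x y * ‖f t‖ := by
        refine norm_integral_le_of_norm_le (hf.norm.const_mul _) (.of_forall fun t => ?_)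
        rw [← sub_smul, norm_smul]
        gcongr
        simpa [dist_eq_norm] using hL.norm_sub_le (x - t) (y - t)
    _ = L * (∫ t, ‖f t‖) * dist x y := by rw [integral_const_mul]; ring

lemma support_mollify_subset {k : ℕ} {f : E → F} {K : Set E} (hf : ∀ x ∉ K, f x = 0) :
    Function.support (mollify k f) ⊆ Metric.cthickening (1 / (k + 1)) K := by
  refine fun x hx => by_contra fun hxK => hx ?_
  rw [mollify_apply]
  refine integral_eq_zero_of_ae (.of_forall fun t => ?_)
  by_cases ht : t ∈ K
  · have hfar : x - t ∉ Function.support (mollifier E k) := by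
      rw [support_mollifier, mem_ball_zero_iff, ← dist_eq_norm]
      exact fun h => hxK (Metric.mem_cthickening_of_dist_le x t _ K ht h.le)
    simp [Function.notMem_support.1 hfar]
  · simp [hf t ht]

lemma tsupport_mollify_subset {k : ℕ} {f : E → F} {K : Set E} (hf : ∀ x ∉ K, f x = 0) :
    tsupport (mollify k f) ⊆ Metric.cthickening (1 / (k + 1)) K :=
  closure_minimal (support_mollify_subset hf) Metric.isClosed_cthickening

lemma hasCompactSupport_mollify {k : ℕ} {f : E → F} {K : Set E} (hK : IsCompact K)
    (hf : ∀ x ∉ K, f x = 0) : HasCompactSupport (mollify k f) :=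
  hK.cthickening.of_isClosed_subset (isClosed_tsupport _) (tsupport_mollify_subset hf)

lemma norm_mollify_le (k : ℕ) {f : E → F} {g : E → ℝ} (hg : LocallyIntegrable g)
    (h : ∀ᵐ x, ‖f x‖ ≤ g x) (x : E) : ‖mollify k f x‖ ≤ mollify k g x := by
  rw [mollify_apply, mollify_apply]
  refine norm_integral_le_of_norm_le (integrable_mollifier_smul k hg x) ?_
  filter_upwards [h] with t ht
  rw [norm_smul, Real.norm_of_nonneg (mollifier_nonneg k _), smul_eq_mul]
  exact mul_le_mul_of_nonneg_left ht (mollifier_nonneg k _)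

lemma mollify_const (k : ℕ) (c : ℝ) (x : E) : mollify k (fun _ => c) x = c := by
  simp [mollify_apply, integral_mul_const, integral_mollifier_sub]

lemma norm_mollify_le_const (k : ℕ) {f : E → F} {c : ℝ} (h : ∀ᵐ x, ‖f x‖ ≤ c) (x : E) :
    ‖mollify k f x‖ ≤ c :=
  (norm_mollify_le k (locallyIntegrable_const c) h x).trans_eq (mollify_const k c x)

lemma ae_tendsto_mollify [CompleteSpace F] {f : E → F} (hf : LocallyIntegrable f) :
    ∀ᵐ x, Tendsto (fun k => mollify k f x) atTop (𝓝 (f x)) :=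
  ContDiffBump.ae_convolution_tendsto_right_of_locallyIntegrable (K := 2)
    (tendsto_mollifierBump_rOut E) (.of_forall fun _ => (mul_div_cancel₀ _ two_ne_zero).ge) hf

lemma tendsto_mollify [CompleteSpace F] {f : E → F} (hf : Continuous f) (x : E) :
    Tendsto (fun k => mollify k f x) atTop (𝓝 (f x)) :=
  ContDiffBump.convolution_tendsto_right_of_continuous (tendsto_mollifierBump_rOut E) hf x

lemma tendsto_integral_mul_mollify {A : Set E} {u h : E → ℝ} (hu : IntegrableOn u A) {M : ℝ}
    (hint : LocallyIntegrable h) (hM : ∀ x, ‖h x‖ ≤ M) :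
    Tendsto (fun k => ∫ x in A, u x * mollify k h x) atTop (𝓝 (∫ x in A, u x * h x)) := by
  refine tendsto_integral_of_dominated_convergence (fun x => ‖u x‖ * M) (fun k => ?_)
    (hu.norm.mul_const M) (fun k => .of_forall fun x => ?_) ?_
  · exact hu.aestronglyMeasurable.mul
      (contDiff_mollify k hint (n := 0)).continuous.aestronglyMeasurable
  · rw [norm_mul]
    exact mul_le_mul_of_nonneg_left (norm_mollify_le_const k (.of_forall hM) x) (norm_nonneg _)
  · filter_upwards [ae_restrict_of_ae (ae_tendsto_mollify hint)] with x hx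
    exact hx.const_mul _

end Mollification

/-! ### Weak divergences -/

/-- `h` is the distributional divergence of the vector field `Φ` on `ℝ^m`. -/
def HasWeakDiv (Φ : Eu m → Eu m) (h : Eu m → ℝ) : Prop :=
  ∀ ψ : Eu m → ℝ, ContDiff ℝ ∞ ψ → HasCompactSupport ψ →
    ∫ x, ψ x * h x = -∫ x, fderiv ℝ ψ x (Φ x)

lemma HasWeakDiv.add {Φ Φ' : Eu m → Eu m} {h h' : Eu m → ℝ} (H : HasWeakDiv Φ h)
    (H' : HasWeakDiv Φ' h') (hΦ : Integrable Φ) (hΦ' : Integrable Φ') (hh : Integrable h)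
    (hh' : Integrable h') : HasWeakDiv (Φ + Φ') (h + h') := by
  intro ψ hψ hψc
  have hint {g : Eu m → ℝ} (hg : Integrable g) : Integrable (fun x => ψ x * g x) :=
    hg.locallyIntegrable.integrable_smul_left_of_hasCompactSupport hψ.continuous hψc
  have hint' {Ψ : Eu m → Eu m} (hΨ : Integrable Ψ) : Integrable (fun x => fderiv ℝ ψ x (Ψ x)) := by
    have hcont : Continuous (fderiv ℝ ψ) := hψ.continuous_fderiv (by simp)
    obtain ⟨C, hC⟩ := (hψc.fderiv ℝ).exists_bound_of_continuous hcont
    refine (hΨ.norm.const_mul C).mono' ?_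
      (.of_forall fun x => (fderiv ℝ ψ x).le_of_opNorm_le (hC x) _)
    exact (ContinuousLinearMap.id ℝ (Eu m →L[ℝ] ℝ)).aestronglyMeasurable_comp₂
      hcont.aestronglyMeasurable hΨ.aestronglyMeasurable
  simp only [Pi.add_apply, mul_add, map_add]
  rw [integral_add (hint hh) (hint hh'), integral_add (hint' hΦ) (hint' hΦ'), H ψ hψ hψc,
    H' ψ hψ hψc, neg_add]

lemma divergence_mollify (k : ℕ) {Φ : Eu m → Eu m} (hΦ : LocallyIntegrable Φ) (x : Eu m) :
    divergence (mollify k Φ) x = ∫ t, fderiv ℝ (mollifier (Eu m) k) (x - t) (Φ t) := by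
  rw [← traceCLM_fderiv, fderiv_mollify k hΦ,
    ← (traceCLM m).integral_comp_comm (integrable_fderiv_mollifier_smulRight k hΦ x)]
  simp only [traceCLM_smulRight]

lemma HasWeakDiv.divergence_mollify {Φ : Eu m → Eu m} {h : Eu m → ℝ} (H : HasWeakDiv Φ h)
    (hΦ : LocallyIntegrable Φ) (k : ℕ) (x : Eu m) :
    divergence (mollify k Φ) x = mollify k h x := by
  have hx := H _ (contDiff_mollifier_sub k x) (hasCompactSupport_mollifier_sub k x)
  simp only [fderiv_mollifier_sub, neg_apply, integral_neg, neg_neg] at hx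
  simpa [mollify_apply, TVReg.divergence_mollify k hΦ] using hx.symm

/-- A vector field `Φ` with bounded distributional divergence `h`, both vanishing off a compact
subset of `A`.  By mollification such a field competes in the supremum defining `TV A`. -/
structure IsWeakTestField (A : Set (Eu m)) (Φ : Eu m → Eu m) (h : Eu m → ℝ) : Prop where
  integrable : Integrable Φ
  integrable_div : Integrable h
  bounded_div : ∃ M, ∀ x, ‖h x‖ ≤ M
  exists_isCompact : ∃ K ⊆ A, IsCompact K ∧ ∀ x ∉ K, Φ x = 0 ∧ h x = 0
  hasWeakDiv : HasWeakDiv Φ h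

namespace IsWeakTestField

variable {A B : Set (Eu m)} {Φ Φ' : Eu m → Eu m} {h h' : Eu m → ℝ} {u : Eu m → ℝ}

lemma mono (H : IsWeakTestField A Φ h) (hAB : A ⊆ B) : IsWeakTestField B Φ h where
  __ := H
  exists_isCompact := H.exists_isCompact.imp fun _ hK => ⟨hK.1.trans hAB, hK.2⟩

lemma add (H : IsWeakTestField A Φ h) (H' : IsWeakTestField A Φ' h') :
    IsWeakTestField A (Φ + Φ') (h + h') where
  integrable := H.integrable.add H'.integrable
  integrable_div := H.integrable_div.add H'.integrable_div
  bounded_div := by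
    obtain ⟨M, hM⟩ := H.bounded_div
    obtain ⟨M', hM'⟩ := H'.bounded_div
    exact ⟨M + M', fun x => norm_add_le_of_le (hM x) (hM' x)⟩
  exists_isCompact := by
    obtain ⟨K, hKA, hK, h0⟩ := H.exists_isCompact
    obtain ⟨K', hKA', hK', h0'⟩ := H'.exists_isCompact
    refine ⟨K ∪ K', union_subset hKA hKA', hK.union hK', fun x hx => ?_⟩
    rw [mem_union, not_or] at hx
    simp [h0 x hx.1, h0' x hx.2]
  hasWeakDiv := H.hasWeakDiv.add H'.hasWeakDiv H.integrable H'.integrable H.integrable_div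
    H'.integrable_div

lemma integrable_mul (H : IsWeakTestField A Φ h) (hu : IntegrableOn u B) :
    IntegrableOn (fun x => u x * h x) B := by
  obtain ⟨M, hM⟩ := H.bounded_div
  exact hu.mul_bdd (c := M) H.integrable_div.aestronglyMeasurable.restrict (.of_forall hM)

lemma setIntegral_eq (H : IsWeakTestField A Φ h) (hB : MeasurableSet B) (hAB : A ⊆ B)
    (u : Eu m → ℝ) : ∫ x in A, u x * h x = ∫ x in B, u x * h x := by
  obtain ⟨K, hKA, -, h0⟩ := H.exists_isCompact
  refine (setIntegral_eq_of_subset_of_forall_sdiff_eq_zero hB hAB fun x hx => ?_).symm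
  rw [(h0 x fun hxK => hx.2 (hKA hxK)).2, mul_zero]

lemma tendsto_integral_mul_divergence_mollify (H : IsWeakTestField A Φ h) (hu : IntegrableOn u A) :
    Tendsto (fun k => ∫ x in A, u x * divergence (mollify k Φ) x) atTop
      (𝓝 (∫ x in A, u x * h x)) := by
  obtain ⟨M, hM⟩ := H.bounded_div
  simp only [H.hasWeakDiv.divergence_mollify H.integrable.locallyIntegrable]
  exact tendsto_integral_mul_mollify hu H.integrable_div.locallyIntegrable hM

lemma eventually_mollify (H : IsWeakTestField A Φ h) (hA : IsOpen A) :
    ∀ᶠ k in atTop, ContDiff ℝ ∞ (mollify k Φ) ∧ HasCompactSupport (mollify k Φ) ∧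
      tsupport (mollify k Φ) ⊆ A := by
  obtain ⟨K, hKA, hK, h0⟩ := H.exists_isCompact
  filter_upwards [eventually_cthickening_subset hK hA hKA] with k hk
  exact ⟨contDiff_mollify k H.integrable.locallyIntegrable,
    hasCompactSupport_mollify hK fun x hx => (h0 x hx).1,
    (tsupport_mollify_subset fun x hx => (h0 x hx).1).trans hk⟩

lemma ofReal_integral_le (H : IsWeakTestField A Φ h) (hA : IsOpen A) {c : ℝ}
    (hc : ∀ᵐ x, ‖Φ x‖ ≤ c) (hu : IntegrableOn u A) :
    ENNReal.ofReal (∫ x in A, u x * h x) ≤ ENNReal.ofReal c * TV A u := by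
  refine le_of_tendsto ((ENNReal.continuous_ofReal.tendsto _).comp
    (H.tendsto_integral_mul_divergence_mollify hu)) ?_
  filter_upwards [H.eventually_mollify hA] with k ⟨hk, hkc, hks⟩
  exact ofReal_integral_le_mul_TV u hk hkc hks (norm_mollify_le_const k hc)

end IsWeakTestField

/-! ### Gradient measures -/

instance isFiniteMeasure_variation {X F : Type*} [MeasurableSpace X] [NormedAddCommGroup F]
    [NormedSpace ℝ F] [FiniteDimensional ℝ F] (μ : VectorMeasure X F) :
    IsFiniteMeasure μ.variation := by
  let b := Module.finBasis ℝ F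
  let coord i : F →L[ℝ] ℝ := (b.coord i).toContinuousLinearMap
  let c i : SignedMeasure X := μ.mapRange (coord i).toLinearMap.toAddMonoidHom (coord i).continuous
  have hle : μ.variation ≤ ∑ i, ‖b i‖₊ • (c i).totalVariation := by
    refine VectorMeasure.variation_le_of_forall_enorm_le fun E _ => ?_
    rw [Measure.finsetSum_apply]
    calc ‖μ E‖ₑ = ‖∑ i, b.repr (μ E) i • b i‖ₑ := by rw [b.sum_repr]
      _ ≤ ∑ i, ‖b.repr (μ E) i • b i‖ₑ := enorm_sum_le _ _
      _ ≤ ∑ i, (‖b i‖₊ • (c i).totalVariation) E := Finset.sum_le_sum fun i _ => by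
          rw [enorm_smul, mul_comm]
          exact mul_le_mul_right (SignedMeasure.enorm_le_totalVariation (c i) E) _
  exact isFiniteMeasure_of_le _ hle

lemma inner_integral_smul {X F : Type*} [MeasurableSpace X] [NormedAddCommGroup F]
    [InnerProductSpace ℝ F] [CompleteSpace F] (μ : VectorMeasure X F) {f : X → ℝ}
    (hf : Integrable f μ.variation) (e : F) :
    inner ℝ e (∫ᵛ x, f x ∂•μ) = ∫ᵛ x, f x • e ∂[innerSL ℝ; μ] := by
  calc inner ℝ e (∫ᵛ x, f x ∂•μ)
    _ = ∫ᵛ x, f x ∂[.compL ℝ F F ℝ (innerSL ℝ e) ∘L .lsmul ℝ ℝ; μ] :=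
        VectorMeasure.continuousLinearMap_apply_integral (C := innerSL ℝ e) hf
    _ = ∫ᵛ x, f x ∂[innerSL ℝ ∘L (ContinuousLinearMap.id ℝ ℝ).smulRight e; μ] := by
        congr 1
        ext v
        simp [innerSL_apply_apply ℝ e v]
    _ = ∫ᵛ x, f x • e ∂[innerSL ℝ; μ] :=
        (VectorMeasure.integral_continuousLinearMap_comp
          (C := (ContinuousLinearMap.id ℝ ℝ).smulRight e) hf).symm

lemma inner_gradient_right {E : Type*} [NormedAddCommGroup E] [InnerProductSpace ℝ E]
    [CompleteSpace E] (ψ : E → ℝ) (x e : E) : inner ℝ e (∇ ψ x) = fderiv ℝ ψ x e := by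
  rw [real_inner_comm, gradient, InnerProductSpace.toDual_symm_apply]

lemma integrable_smul_gradient {ν : Measure (Eu m)} {u : Eu m → ℝ} (hu : Integrable u ν)
    {ψ : Eu m → ℝ} (hψ : ContDiff ℝ 1 ψ) (hc : HasCompactSupport ψ) :
    Integrable (fun x => u x • ∇ ψ x) ν := by
  have hcont : Continuous (fderiv ℝ ψ) := hψ.continuous_fderiv one_ne_zero
  obtain ⟨C, hC⟩ := (hc.fderiv ℝ).exists_bound_of_continuous hcont
  refine hu.smul_bdd C ((InnerProductSpace.toDual ℝ (Eu m)).symm.continuous.comp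
    hcont).aestronglyMeasurable (.of_forall fun x => ?_)
  rw [gradient, LinearIsometryEquiv.norm_map]
  exact hC x

lemma integrable_coe_of_hasCompactSupport {E F : Type*} [TopologicalSpace E]
    [SecondCountableTopology E] [MeasurableSpace E] [OpensMeasurableSpace E]
    [NormedAddCommGroup F] {Ω : Set E} (ν : Measure Ω) [IsFiniteMeasure ν] {η : E → F}
    (hη : Continuous η) (hc : HasCompactSupport η) : Integrable (fun x : Ω => η x) ν := by
  obtain ⟨C, hC⟩ := hc.exists_bound_of_continuous hη
  exact .of_bound (hη.comp continuous_subtype_val).aestronglyMeasurable C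
    (.of_forall fun x => hC x)

namespace HasGradientMeasure

variable {Ω : Set (Eu m)} {u : Eu m → ℝ} {μ : VectorMeasure Ω (Eu m)}

lemma integral_mul_fderiv (h : HasGradientMeasure Ω u μ) (hu : IntegrableOn u Ω) {ψ : Eu m → ℝ}
    (hψ : ContDiff ℝ ∞ ψ) (hc : HasCompactSupport ψ) (hs : tsupport ψ ⊆ Ω) (e : Eu m) :
    ∫ x in Ω, u x * fderiv ℝ ψ x e = -∫ᵛ x : Ω, ψ x • e ∂[innerSL ℝ; μ] := by
  rw [← inner_integral_smul μ (integrable_coe_of_hasCompactSupport _ hψ.continuous hc),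
    ← inner_neg_right, ← h ψ hψ hc hs,
    ← integral_inner (integrable_smul_gradient hu (hψ.of_le (by simp)) hc)]
  simp only [inner_smul_right, inner_gradient_right]

lemma integral_mul_divergence (h : HasGradientMeasure Ω u μ) (hu : IntegrableOn u Ω)
    {η : Eu m → Eu m} (hη : ContDiff ℝ ∞ η) (hc : HasCompactSupport η) (hs : tsupport η ⊆ Ω) :
    ∫ x in Ω, u x * divergence η x = -∫ᵛ x : Ω, η x ∂[innerSL ℝ; μ] := by
  have hcoord (i) : ContDiff ℝ ∞ (fun x => η x i) :=
    (EuclideanSpace.proj (𝕜 := ℝ) i).contDiff.comp hη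
  have hcs (i) : HasCompactSupport (fun x => η x i) := hc.comp_left (g := fun v : Eu m => v i) rfl
  have hss (i) : tsupport (fun x => η x i) ⊆ Ω :=
    (tsupport_comp_subset (g := fun v : Eu m => v i) rfl η).trans hs
  have hint (i) : Integrable
      (fun x => u x * fderiv ℝ (fun y => η y i) x (EuclideanSpace.single i 1))
      (volume.restrict Ω) := by
    have hcont := ((hcoord i).continuous_fderiv (by simp)).clm_apply
      (continuous_const (y := EuclideanSpace.single i (1 : ℝ)))
    obtain ⟨C, hC⟩ := ((hcs i).fderiv_apply ℝ _).exists_bound_of_continuous hcont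
    exact hu.mul_bdd (c := C) hcont.aestronglyMeasurable (.of_forall hC)
  calc ∫ x in Ω, u x * divergence η x
    _ = ∑ i, ∫ x in Ω, u x * fderiv ℝ (fun y => η y i) x (EuclideanSpace.single i 1) := by
        simp only [divergence, ← fderiv_apply_coord (hη.differentiable (by simp) _),
          Finset.mul_sum]
        exact integral_finsetSum _ fun i _ => hint i
    _ = -∑ i, ∫ᵛ x : Ω, η x i • EuclideanSpace.single i 1 ∂[innerSL ℝ; μ] := by
        simp only [h.integral_mul_fderiv hu (hcoord _) (hcs _) (hss _), Finset.sum_neg_distrib]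
    _ = -∫ᵛ x : Ω, η x ∂[innerSL ℝ; μ] := by
        rw [← VectorMeasure.integral_finsetSum _ fun i _ => (integrable_coe_of_hasCompactSupport _
          (hcoord i).continuous (hcs i)).smul_const _]
        congr! with x
        simpa using (EuclideanSpace.basisFun (Fin m) ℝ).sum_repr (η x)

lemma abs_integral_mul_divergence_le (h : HasGradientMeasure Ω u μ) (hu : IntegrableOn u Ω)
    {η : Eu m → Eu m} (hη : ContDiff ℝ ∞ η) (hc : HasCompactSupport η) (hs : tsupport η ⊆ Ω) :
    |∫ x in Ω, u x * divergence η x| ≤ ∫ x : Ω, ‖η x‖ ∂μ.variation := by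
  rw [h.integral_mul_divergence hu hη hc hs, abs_neg]
  exact VectorMeasure.norm_integral_le_integral_norm.trans
    (mul_le_of_le_one_left (integral_nonneg fun x : Ω => norm_nonneg (η x)) (norm_innerSL_le ℝ))

lemma abs_integral_mul_le (h : HasGradientMeasure Ω u μ) (hu : IntegrableOn u Ω) (hΩ : IsOpen Ω)
    {Φ : Eu m → Eu m} {δ : Eu m → ℝ} (H : IsWeakTestField Ω Φ δ) {g : Eu m → ℝ}
    (hg : Continuous g) {C : ℝ} (hC : ∀ x, ‖g x‖ ≤ C) (hΦg : ∀ᵐ x, ‖Φ x‖ ≤ g x) :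
    |∫ x in Ω, u x * δ x| ≤ ∫ x : Ω, g x ∂μ.variation := by
  have hmollify (k) : Continuous fun x : Ω => mollify k g x :=
    (contDiff_mollify k hg.locallyIntegrable (n := 0)).continuous.comp continuous_subtype_val
  have hbound (k) (x : Ω) : ‖mollify k g x‖ ≤ C := norm_mollify_le_const k (.of_forall hC) x
  have hlim : Tendsto (fun k => ∫ x : Ω, mollify k g x ∂μ.variation) atTop
      (𝓝 (∫ x : Ω, g x ∂μ.variation)) :=
    tendsto_integral_of_dominated_convergence (fun _ => C)
      (fun k => (hmollify k).aestronglyMeasurable) (integrable_const _)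
      (fun k => .of_forall (hbound k)) (.of_forall fun x => tendsto_mollify hg x)
  refine le_of_tendsto_of_tendsto (H.tendsto_integral_mul_divergence_mollify hu).abs hlim ?_
  filter_upwards [H.eventually_mollify hΩ] with k ⟨hk, hkc, hks⟩
  refine (h.abs_integral_mul_divergence_le hu hk hkc hks).trans (integral_mono
    (integrable_coe_of_hasCompactSupport _ hk.continuous hkc).norm
    (.of_bound (hmollify k).aestronglyMeasurable C (.of_forall (hbound k))) fun x => ?_)
  exact norm_mollify_le k hg.locallyIntegrable hΦg x

end HasGradientMeasure

lemma setIntegral_mul_divergence_eq {Ω B : Set (Eu m)} (hΩ : MeasurableSet Ω) (hBΩ : B ⊆ Ω)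
    (u : Eu m → ℝ) {η : Eu m → Eu m} (hs : tsupport η ⊆ B) :
    ∫ x in B, u x * divergence η x = ∫ x in Ω, u x * divergence η x := by
  refine (setIntegral_eq_of_subset_of_forall_sdiff_eq_zero hΩ hBΩ fun x hx => ?_).symm
  rw [divergence_eq_zero fun h => hx.2 (hs h), mul_zero]

lemma HasGradientMeasure.TV_le_varOn {Ω : Set (Eu m)} {u : Eu m → ℝ}
    {μ : VectorMeasure Ω (Eu m)} (h : HasGradientMeasure Ω u μ) (hu : IntegrableOn u Ω)
    (hΩ : MeasurableSet Ω) {B : Set (Eu m)} (hB : MeasurableSet B) (hBΩ : B ⊆ Ω) :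
    TV B u ≤ varOn μ B := by
  refine iSup₂_le fun φ hφ => ENNReal.ofReal_le_of_le_toReal ?_
  have hBm : MeasurableSet ((↑) ⁻¹' B : Set Ω) := hB.preimage measurable_subtype_coe
  rw [setIntegral_mul_divergence_eq hΩ hBΩ u hφ.tsupport_subset]
  calc ∫ x in Ω, u x * divergence φ x
    _ ≤ ∫ x : Ω, ‖φ x‖ ∂μ.variation := (le_abs_self _).trans <|
        h.abs_integral_mul_divergence_le hu hφ.contDiff hφ.hasCompactSupport
          (hφ.tsupport_subset.trans hBΩ)
    _ ≤ ∫ x : Ω, ((↑) ⁻¹' B : Set Ω).indicator 1 x ∂μ.variation := by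
        refine integral_mono (integrable_coe_of_hasCompactSupport _ hφ.contDiff.continuous
          hφ.hasCompactSupport).norm ((integrable_const 1).indicator hBm) fun x => ?_
        refine le_indicator_apply (fun _ => hφ.norm_le_one _) fun hx => ?_
        rw [image_eq_zero_of_notMem_tsupport fun hx' => hx (hφ.tsupport_subset hx'), norm_zero]
    _ = (varOn μ B).toReal := integral_indicator_one hBm

/-! ### The variation of a gradient measure on open sets -/

lemma norm_normalize_le_one {F : Type*} [NormedAddCommGroup F] [NormedSpace ℝ F] (w : F) :
    ‖NormedSpace.normalize w‖ ≤ 1 := by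
  rw [NormedSpace.normalize, norm_smul, norm_inv, norm_norm]
  exact inv_mul_le_one

lemma inner_normalize_self {F : Type*} [NormedAddCommGroup F] [InnerProductSpace ℝ F] (w : F) :
    inner ℝ (NormedSpace.normalize w) w = ‖w‖ := by
  conv_lhs => enter [3]; rw [← NormedSpace.norm_smul_normalize w]
  rcases eq_or_ne w 0 with rfl | hw
  · simp
  · rw [inner_smul_right, real_inner_self_eq_norm_sq, NormedSpace.norm_normalize hw, one_pow,
      mul_one]

lemma exists_contDiff_eq_one_of_isCompact {E : Type*} [NormedAddCommGroup E] [NormedSpace ℝ E]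
    [FiniteDimensional ℝ E] {K U : Set E} (hK : IsCompact K) (hU : IsOpen U) (hKU : K ⊆ U) :
    ∃ ψ : E → ℝ, ContDiff ℝ ∞ ψ ∧ HasCompactSupport ψ ∧ tsupport ψ ⊆ U ∧
      (∀ x ∈ K, ψ x = 1) ∧ ∀ x, ψ x ∈ Icc (0 : ℝ) 1 := by
  obtain ⟨L, hL, hKL, hLU⟩ := exists_compact_between hK hU hKU
  obtain ⟨f, hf0, hf1, hf⟩ := exists_contMDiffMap_zero_one_of_isClosed (n := (⊤ : ℕ∞))
    (modelWithCornersSelf ℝ E) (isOpen_interior (s := L)).isClosed_compl hK.isClosed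
    (disjoint_compl_left_iff_subset.2 hKL)
  have hsupp : tsupport f ⊆ L := closure_minimal (fun x hx => by
    by_contra h
    exact hx (hf0 fun h' => h (interior_subset h'))) hL.isClosed
  exact ⟨f, f.contMDiff.contDiff, hL.of_isClosed_subset (isClosed_tsupport _) hsupp,
    hsupp.trans hLU, fun x hx => hf1 hx, hf⟩

lemma norm_integral_sub_apply_le {X F : Type*} [MeasurableSpace X] [NormedAddCommGroup F]
    [NormedSpace ℝ F] [FiniteDimensional ℝ F] (μ : VectorMeasure X F) {ψ : X → ℝ}
    (hψ : Integrable ψ μ.variation) {K O : Set X} (hK : MeasurableSet K) (hO : MeasurableSet O)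
    (h1 : ∀ x ∈ K, ψ x = 1) (h0 : ∀ x ∉ O, ψ x = 0) (h01 : ∀ x, ψ x ∈ Icc (0 : ℝ) 1) :
    ‖(∫ᵛ x, ψ x ∂•μ) - μ K‖ ≤ μ.variation.real (O \ K) := by
  have : CompleteSpace F := FiniteDimensional.complete ℝ F
  have hint : Integrable (K.indicator (1 : X → ℝ)) μ.variation := (integrable_const 1).indicator hK
  have hone : ∫ᵛ x, K.indicator (1 : X → ℝ) x ∂•μ = μ K :=
    (VectorMeasure.integral_indicator_const (1 : ℝ) hK).trans (by simp)
  calc ‖(∫ᵛ x, ψ x ∂•μ) - μ K‖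
    _ = ‖∫ᵛ x, (ψ x - K.indicator 1 x) ∂•μ‖ := by rw [VectorMeasure.integral_fun_sub hψ hint, hone]
    _ ≤ ∫ x, ‖ψ x - K.indicator 1 x‖ ∂μ.variation :=
        VectorMeasure.norm_integral_le_integral_norm.trans (mul_le_of_le_one_left
          (integral_nonneg fun x => norm_nonneg (ψ x - K.indicator 1 x))
          ContinuousLinearMap.opNorm_lsmul_le)
    _ ≤ ∫ x, (O \ K).indicator 1 x ∂μ.variation := by
        refine integral_mono (hψ.sub hint).norm ((integrable_const 1).indicator (hO.diff hK))
          fun x => ?_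
        by_cases hxK : x ∈ K
        · simp [hxK, h1 x hxK]
        by_cases hxO : x ∈ O
        · simpa [hxK, hxO, abs_of_nonneg (h01 x).1] using (h01 x).2
        · simp [hxK, hxO, h0 x hxO]
    _ = μ.variation.real (O \ K) := integral_indicator_one (hO.diff hK)

lemma exists_contDiff_norm_integral_sub_le {Ω : Set (Eu m)} (hΩ : IsOpen Ω)
    (μ : VectorMeasure Ω (Eu m)) {K : Set Ω} (hK : IsCompact K) {V : Set (Eu m)} (hV : IsOpen V)
    (hKV : (↑) '' K ⊆ V) {δ : ℝ} (hδ : 0 < δ) :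
    ∃ ψ : Eu m → ℝ, ContDiff ℝ ∞ ψ ∧ HasCompactSupport ψ ∧ tsupport ψ ⊆ V ∧
      (∀ x, ψ x ∈ Icc (0 : ℝ) 1) ∧ ‖(∫ᵛ x : Ω, ψ x ∂•μ) - μ K‖ ≤ δ := by
  have : LocallyCompactSpace Ω := hΩ.locallyCompactSpace
  obtain ⟨O, hKO, hO, -, hOδ⟩ := hK.measurableSet.exists_isOpen_sdiff_lt
    (measure_ne_top μ.variation K) (ENNReal.ofReal_pos.2 hδ).ne'
  obtain ⟨ψ, hψ, hψc, hψs, hψ1, hψ01⟩ := exists_contDiff_eq_one_of_isCompact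
    (hK.image continuous_subtype_val) (hV.inter (hΩ.isOpenMap_subtype_val O hO))
    (subset_inter hKV (image_mono hKO))
  refine ⟨ψ, hψ, hψc, hψs.trans inter_subset_left, hψ01, ?_⟩
  refine (norm_integral_sub_apply_le μ (integrable_coe_of_hasCompactSupport _ hψ.continuous hψc)
    hK.measurableSet hO.measurableSet (fun x hx => hψ1 x (mem_image_of_mem _ hx)) (fun x hx => ?_)
    fun x => hψ01 x).trans (ENNReal.toReal_le_of_le_ofReal hδ.le hOδ.le)
  refine image_eq_zero_of_notMem_tsupport fun hx' => hx ?_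
  exact Subtype.val_injective.mem_set_image.1 (hψs hx').2

lemma norm_apply_le_add_variation_sdiff {X F : Type*} [MeasurableSpace X] [NormedAddCommGroup F]
    [NormedSpace ℝ F] [FiniteDimensional ℝ F] (μ : VectorMeasure X F) {K p : Set X}
    (hK : MeasurableSet K) (hp : MeasurableSet p) (hKp : K ⊆ p) :
    ‖μ p‖ ≤ ‖μ K‖ + μ.variation.real (p \ K) := by
  rw [← VectorMeasure.of_add_of_sdiff hK hp hKp]
  exact norm_add_le_of_le le_rfl
    (VectorMeasure.norm_measure_le_variation (measure_ne_top μ.variation _))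

lemma exists_isOpen_pairwiseDisjoint {X ι : Type*} [TopologicalSpace X] [T2Space X]
    {P : Finset ι} {K : ι → Set X} (hK : ∀ p ∈ P, IsCompact (K p))
    (hd : (P : Set ι).PairwiseDisjoint K) :
    ∃ V : ι → Set X, (∀ p, IsOpen (V p) ∧ K p ⊆ V p) ∧ (P : Set ι).PairwiseDisjoint V := by
  refine Set.PairwiseDisjoint.exists_mem_filter_basis (l := fun p => 𝓝ˢ (K p))
    (fun p hp q hq hpq => ?_) P.finite_toSet fun p => hasBasis_nhdsSet (K p)
  exact separatedNhds_iff_disjoint.1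
    (SeparatedNhds.of_isCompact_isCompact (hK p hp) (hK q hq) (hd hp hq hpq))

lemma exists_disjoint_bumps {Ω B : Set (Eu m)} (hΩ : IsOpen Ω) (hB : IsOpen B)
    (μ : VectorMeasure Ω (Eu m)) {P : Finset (Set Ω)} (hPB : ∀ p ∈ P, p ⊆ (↑) ⁻¹' B)
    (hPd : (P : Set (Set Ω)).PairwiseDisjoint id) (hPm : ∀ p ∈ P, MeasurableSet p) {δ : ℝ}
    (hδ : 0 < δ) :
    ∃ ψ : Set Ω → Eu m → ℝ,
      (P : Set (Set Ω)).PairwiseDisjoint (fun p => tsupport (ψ p)) ∧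
      ∀ p ∈ P, ContDiff ℝ ∞ (ψ p) ∧ HasCompactSupport (ψ p) ∧ tsupport (ψ p) ⊆ B ∧
        (∀ x, ψ p x ∈ Icc (0 : ℝ) 1) ∧ ‖μ p‖ ≤ ‖∫ᵛ x : Ω, ψ p x ∂•μ‖ + δ := by
  have : LocallyCompactSpace Ω := hΩ.locallyCompactSpace
  have hK (p) (hp : p ∈ P) := (hPm p hp).exists_isCompact_sdiff_lt
    (measure_ne_top μ.variation p) (ENNReal.ofReal_pos.2 (half_pos hδ)).ne'
  choose! K hKp hKc hKδ using hK
  obtain ⟨V, hV, hVd⟩ := exists_isOpen_pairwiseDisjoint (K := fun p => ((↑) '' K p : Set (Eu m)))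
    (fun p hp => (hKc p hp).image continuous_subtype_val) fun p hp q hq hpq =>
      (disjoint_image_iff Subtype.val_injective).2 ((hPd hp hq hpq).mono (hKp p hp) (hKp q hq))
  have hψ (p) (hp : p ∈ P) := exists_contDiff_norm_integral_sub_le hΩ μ (hKc p hp)
    ((hV p).1.inter hB) (subset_inter (hV p).2 (image_subset_iff.2 ((hKp p hp).trans (hPB p hp))))
    (half_pos hδ)
  choose! ψ hψ hψc hψs hψ01 hψδ using hψ
  refine ⟨ψ, fun p hp q hq hpq => (hVd hp hq hpq).mono ((hψs p hp).trans inter_subset_left)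
    ((hψs q hq).trans inter_subset_left), fun p hp => ⟨hψ p hp, hψc p hp,
      (hψs p hp).trans inter_subset_right, hψ01 p hp, ?_⟩⟩
  have h1 := norm_apply_le_add_variation_sdiff μ (hKc p hp).measurableSet (hPm p hp) (hKp p hp)
  have h2 : μ.variation.real (p \ K p) ≤ δ / 2 :=
    ENNReal.toReal_le_of_le_ofReal (half_pos hδ).le (hKδ p hp).le
  linarith [norm_le_norm_add_norm_sub (∫ᵛ x : Ω, ψ p x ∂•μ) (μ (K p)), hψδ p hp]

lemma isTestField_sum_smul {ι : Type*} {B : Set (Eu m)} {P : Finset ι} {ψ : ι → Eu m → ℝ}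
    {v : ι → Eu m} (hd : (P : Set ι).PairwiseDisjoint fun p => tsupport (ψ p))
    (hψ : ∀ p ∈ P, ContDiff ℝ ∞ (ψ p)) (hψc : ∀ p ∈ P, HasCompactSupport (ψ p))
    (hψs : ∀ p ∈ P, tsupport (ψ p) ⊆ B) (hψ1 : ∀ p ∈ P, ∀ x, ‖ψ p x‖ ≤ 1)
    (hv : ∀ p, ‖v p‖ ≤ 1) : IsTestField B fun x => ∑ p ∈ P, ψ p x • v p := by
  have hcomp : IsCompact (⋃ p ∈ P, tsupport (ψ p)) := P.isCompact_biUnion hψc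
  have htsupp : tsupport (fun x => ∑ p ∈ P, ψ p x • v p) ⊆ ⋃ p ∈ P, tsupport (ψ p) := by
    refine closure_minimal (fun x hx => ?_) hcomp.isClosed
    obtain ⟨p, hp, hpx⟩ := Finset.exists_ne_zero_of_sum_ne_zero hx
    exact mem_biUnion hp (subset_tsupport _ (left_ne_zero_of_smul hpx))
  refine ⟨ContDiff.sum fun p hp => (hψ p hp).smul contDiff_const,
    hcomp.of_isClosed_subset (isClosed_tsupport _) htsupp,
    htsupp.trans (iUnion₂_subset hψs), fun x => ?_⟩
  by_cases hx : ∃ p ∈ P, x ∈ tsupport (ψ p)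
  · obtain ⟨p, hp, hxp⟩ := hx
    rw [Finset.sum_eq_single_of_mem p hp fun q hq hqp => ?_, norm_smul]
    · exact mul_le_one₀ (hψ1 p hp x) (norm_nonneg _) (hv p)
    · rw [image_eq_zero_of_notMem_tsupport fun hxq => disjoint_left.1 (hd hq hp hqp) hxq hxp,
        zero_smul]
  · rw [Finset.sum_eq_zero fun p hp => ?_, norm_zero]
    · exact zero_le_one
    · rw [image_eq_zero_of_notMem_tsupport fun hxp => hx ⟨p, hp, hxp⟩, zero_smul]

namespace HasGradientMeasure

variable {Ω : Set (Eu m)} {u : Eu m → ℝ} {μ : VectorMeasure Ω (Eu m)}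

lemma ofReal_sum_norm_sub_le_TV (h : HasGradientMeasure Ω u μ) (hu : IntegrableOn u Ω)
    (hΩ : IsOpen Ω) {B : Set (Eu m)} (hB : IsOpen B) (hBΩ : B ⊆ Ω) {P : Finset (Set Ω)}
    (hPB : ∀ p ∈ P, p ⊆ (↑) ⁻¹' B) (hPd : (P : Set (Set Ω)).PairwiseDisjoint id)
    (hPm : ∀ p ∈ P, MeasurableSet p) {δ : ℝ} (hδ : 0 < δ) :
    ENNReal.ofReal (∑ p ∈ P, (‖μ p‖ - δ)) ≤ TV B u := by
  obtain ⟨ψ, hψd, hψ⟩ := exists_disjoint_bumps hΩ hB μ hPB hPd hPm hδ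
  choose hψs hψc hψB hψ01 hψδ using hψ
  let w p : Eu m := ∫ᵛ x : Ω, ψ p x ∂•μ
  let v p : Eu m := -NormedSpace.normalize (w p)
  have hφ : IsTestField B fun x => ∑ p ∈ P, ψ p x • v p :=
    isTestField_sum_smul hψd hψs hψc hψB
      (fun p hp x => (Real.norm_of_nonneg (hψ01 p hp x).1).trans_le (hψ01 p hp x).2)
      fun p => (norm_neg _).trans_le (norm_normalize_le_one _)
  have hint (p) (hp : p ∈ P) : Integrable (fun x : Ω => ψ p x) μ.variation :=
    integrable_coe_of_hasCompactSupport _ (hψs p hp).continuous (hψc p hp)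
  refine (ENNReal.ofReal_le_ofReal ?_).trans (le_TV u hφ)
  calc ∑ p ∈ P, (‖μ p‖ - δ)
    _ ≤ ∑ p ∈ P, ‖w p‖ := Finset.sum_le_sum fun p hp => sub_le_iff_le_add.2 (hψδ p hp)
    _ = -∑ p ∈ P, ∫ᵛ x : Ω, ψ p x • v p ∂[innerSL ℝ; μ] := by
        rw [← Finset.sum_neg_distrib]
        refine Finset.sum_congr rfl fun p hp => ?_
        rw [← inner_integral_smul μ (hint p hp), inner_neg_left, neg_neg, inner_normalize_self]
    _ = ∫ x in B, u x * divergence (fun x => ∑ p ∈ P, ψ p x • v p) x := by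
        rw [setIntegral_mul_divergence_eq hΩ.measurableSet hBΩ u hφ.tsupport_subset,
          h.integral_mul_divergence hu hφ.contDiff hφ.hasCompactSupport
            (hφ.tsupport_subset.trans hBΩ),
          ← VectorMeasure.integral_finsetSum P fun p hp => (hint p hp).smul_const (v p)]

theorem varOn_eq_TV (h : HasGradientMeasure Ω u μ) (hu : IntegrableOn u Ω) (hΩ : IsOpen Ω)
    {B : Set (Eu m)} (hB : IsOpen B) (hBΩ : B ⊆ Ω) : varOn μ B = TV B u := by
  refine le_antisymm (le_of_forall_lt_imp_le_of_dense fun a ha => ?_)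
    (h.TV_le_varOn hu hΩ.measurableSet hB.measurableSet hBΩ)
  obtain ⟨P, hPB, hPd, hPm, haP⟩ := VectorMeasure.exists_lt_sum_of_lt_variation μ
    (hB.measurableSet.preimage measurable_subtype_coe) ha
  have hsum : ∑ p ∈ P, ‖μ p‖ₑ = ENNReal.ofReal (∑ p ∈ P, (‖μ p‖ - 0)) := by
    simp [ENNReal.ofReal_sum_of_nonneg]
  have hlim : Tendsto (fun δ : ℝ => ENNReal.ofReal (∑ p ∈ P, (‖μ p‖ - δ))) (𝓝[>] 0)
      (𝓝 (∑ p ∈ P, ‖μ p‖ₑ)) := by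
    rw [hsum]
    exact tendsto_nhdsWithin_of_tendsto_nhds
      ((ENNReal.continuous_ofReal.comp (by fun_prop)).tendsto 0)
  refine haP.le.trans (le_of_tendsto hlim ?_)
  filter_upwards [self_mem_nhdsWithin] with δ hδ
  exact h.ofReal_sum_norm_sub_le_TV hu hΩ hB hBΩ hPB hPd hPm hδ

end HasGradientMeasure

/-! ### Existence of a gradient measure -/

section withDensity

variable {X F : Type*} [MeasurableSpace X] [NormedAddCommGroup F] [NormedSpace ℝ F]
  [CompleteSpace F] {ν : Measure X} {g : X → F} {f : X → ℝ}

lemma integrable_variation_withDensityᵥ_iff (hg : Integrable g ν) :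
    Integrable f (ν.withDensityᵥ g).variation ↔ Integrable (fun x => ‖g x‖ * f x) ν := by
  rw [Measure.variation_withDensityᵥ hg]
  exact integrable_withDensity_iff_integrable_smul₀ hg.aestronglyMeasurable.nnnorm.aemeasurable

lemma integral_variation_withDensityᵥ (hg : Integrable g ν) :
    ∫ x, f x ∂(ν.withDensityᵥ g).variation = ∫ x, ‖g x‖ * f x ∂ν := by
  rw [Measure.variation_withDensityᵥ hg]
  exact integral_withDensity_eq_integral_smul₀ hg.aestronglyMeasurable.nnnorm.aemeasurable f

lemma integrable_smul_of_integrable_variation (hg : Integrable g ν)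
    (hf : Integrable f (ν.withDensityᵥ g).variation) : Integrable (fun x => f x • g x) ν := by
  rw [integrable_variation_withDensityᵥ_iff hg] at hf
  have heq : (fun x => f x • g x) = fun x => (‖g x‖ * f x) • ‖g x‖⁻¹ • g x := by
    ext1 x
    rcases eq_or_ne (g x) 0 with h0 | h0
    · simp [h0]
    · rw [smul_smul, mul_right_comm, mul_inv_cancel₀ (norm_ne_zero_iff.2 h0), one_mul]
  refine (integrable_norm_iff ?_).1 (hf.norm.congr (.of_forall fun x => ?_))
  · have hinv : AEStronglyMeasurable (fun x => ‖g x‖⁻¹) ν :=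
      hg.aestronglyMeasurable.norm.aemeasurable.inv.aestronglyMeasurable
    rw [heq]
    exact hf.aestronglyMeasurable.smul (hinv.smul hg.aestronglyMeasurable)
  · simp [norm_smul, mul_comm]

lemma ae_eq_smul_of_ae_eq_variation (hg : Integrable g ν) {f' : X → ℝ}
    (h : f =ᵐ[(ν.withDensityᵥ g).variation] f') :
    (fun x => f x • g x) =ᵐ[ν] fun x => f' x • g x := by
  rw [Measure.variation_withDensityᵥ hg] at h
  filter_upwards [(ae_withDensity_iff' hg.aestronglyMeasurable.enorm).1 h] with x hx
  rcases eq_or_ne (g x) 0 with h0 | h0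
  · simp [h0]
  · rw [hx (by simpa using h0)]

lemma lipschitzWith_integral_smul (hg : Integrable g ν) :
    LipschitzWith 1 fun f : X →₁[(ν.withDensityᵥ g).variation] ℝ => ∫ x, f x • g x ∂ν := by
  refine LipschitzWith.of_dist_le_mul fun f₁ f₂ => ?_
  have hint (f : X →₁[(ν.withDensityᵥ g).variation] ℝ) : Integrable (fun x => f x • g x) ν :=
    integrable_smul_of_integrable_variation hg (L1.integrable_coeFn f)
  rw [dist_eq_norm, ← integral_sub (hint f₁) (hint f₂), NNReal.coe_one, one_mul,
    L1.dist_eq_integral_dist, integral_variation_withDensityᵥ hg]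
  refine (norm_integral_le_integral_norm _).trans_eq (integral_congr_ae (.of_forall fun x => ?_))
  simp only [← sub_smul, norm_smul, Real.dist_eq, Real.norm_eq_abs, mul_comm]

lemma integral_withDensityᵥ (hg : Integrable g ν)
    (hf : Integrable f (ν.withDensityᵥ g).variation) :
    ∫ᵛ x, f x ∂•(ν.withDensityᵥ g) = ∫ x, f x • g x ∂ν := by
  refine hf.induction (P := fun f => ∫ᵛ x, f x ∂•(ν.withDensityᵥ g) = ∫ x, f x • g x ∂ν)
    (fun c s hs hs' => ?_) (fun f₁ f₂ _ h₁ h₂ e₁ e₂ => ?_)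
    (isClosed_eq VectorMeasure.continuous_integral (lipschitzWith_integral_smul hg).continuous)
    fun f₁ f₂ h₁₂ _ e₁ => ?_
  · have : IsFiniteMeasure ((ν.withDensityᵥ g).variation.restrict s) :=
      isFiniteMeasure_restrict.2 hs'.ne
    rw [VectorMeasure.integral_indicator_const _ hs]
    have heq : (fun x => s.indicator (fun _ => c) x • g x) = s.indicator fun x => c • g x := by
      ext1 x
      by_cases hx : x ∈ s <;> simp [hx]
    rw [heq, integral_indicator hs, integral_smul, withDensityᵥ_apply hg hs]
    simp
  · rw [VectorMeasure.integral_add h₁ h₂, e₁, e₂]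
    simp only [Pi.add_apply, add_smul]
    exact (integral_add (integrable_smul_of_integrable_variation hg h₁)
      (integrable_smul_of_integrable_variation hg h₂)).symm
  · rw [← VectorMeasure.integral_congr_ae h₁₂, e₁]
    exact integral_congr_ae (ae_eq_smul_of_ae_eq_variation hg h₁₂)

end withDensity

/-- The Riesz representation theorem for a functional that is only defined, and bounded, along a
linear map into a Hilbert space. -/
lemma exists_inner_eq_of_abs_le {V H : Type*} [AddCommGroup V] [Module ℝ V]
    [NormedAddCommGroup H] [InnerProductSpace ℝ H] [CompleteSpace H] (J : V →ₗ[ℝ] H)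
    (T : V →ₗ[ℝ] ℝ) {D : ℝ} (hD : ∀ η, |T η| ≤ D * ‖J η‖) :
    ∃ v : H, ∀ η, T η = inner ℝ v (J η) := by
  obtain ⟨s, hs⟩ := J.rangeRestrict.exists_rightInverse_of_surjective J.range_rangeRestrict
  have hJs (y) : J (s y) = y := congrArg Subtype.val (LinearMap.congr_fun hs y)
  let S := (T ∘ₗ s).mkContinuous D fun y => by simpa [hJs] using hD (s y)
  obtain ⟨G, hG, -⟩ := exists_extension_norm_eq (LinearMap.range J) S
  refine ⟨(InnerProductSpace.toDual ℝ H).symm G, fun η => ?_⟩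
  have hker : T η - T (s (J.rangeRestrict η)) = 0 := by
    simpa [hJs] using hD (η - s (J.rangeRestrict η))
  rw [InnerProductSpace.toDual_symm_apply, sub_eq_zero.1 hker]
  exact (hG (J.rangeRestrict η)).symm

lemma integral_norm_le_sqrt_mul_eLpNorm {X F : Type*} [MeasurableSpace X] [NormedAddCommGroup F]
    {ν : Measure X} [IsFiniteMeasure ν] {f : X → F} (hf : MemLp f 2 ν) :
    ∫ x, ‖f x‖ ∂ν ≤ √(ν.real univ) * (eLpNorm f 2 ν).toReal := by
  have h := ENNReal.toReal_mono (ENNReal.mul_ne_top hf.2.ne (ENNReal.rpow_ne_top_of_nonneg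
    (by norm_num) (measure_ne_top ν univ)))
    (eLpNorm_le_eLpNorm_mul_rpow_measure_univ (p := 1) (q := 2) (by norm_num) hf.1)
  rw [ENNReal.toReal_mul, ← ENNReal.toReal_rpow, eLpNorm_one_eq_lintegral_enorm,
    ← integral_norm_eq_lintegral_enorm hf.1, mul_comm] at h
  norm_num at h
  rwa [Real.sqrt_eq_rpow]

section gradientMeasure

open scoped Distributions
variable {Ω : Set (Eu m)} {hΩ : IsOpen Ω} {w : Eu m → ℝ}

/-- The functional `η ↦ ∫_Ω w div η` on test fields. -/
def divPairing (hw : IntegrableOn w Ω) : 𝓓(⟨Ω, hΩ⟩, Eu m) →ₗ[ℝ] ℝ where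
  toFun η := ∫ x in Ω, w x * divergence η x
  map_add' η χ := by
    have hη : ContDiff ℝ 1 η := η.contDiff.of_le (by simp)
    have hχ : ContDiff ℝ 1 χ := χ.contDiff.of_le (by simp)
    rw [← integral_add (integrable_mul_divergence hw hη η.hasCompactSupport)
      (integrable_mul_divergence hw hχ χ.hasCompactSupport)]
    simp only [FunLike.coe_add, divergence_add (hη.differentiable one_ne_zero _)
      (hχ.differentiable one_ne_zero _), mul_add]
  map_smul' c η := by
    simp only [FunLike.coe_smul, divergence_const_smul, mul_left_comm _ c, integral_const_mul,
      smul_eq_mul, RingHom.id_apply]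

lemma memLp_testFunction (ν : Measure Ω) [IsFiniteMeasure ν] (η : 𝓓(⟨Ω, hΩ⟩, Eu m)) :
    MemLp (fun x : Ω => η x) 2 ν := by
  obtain ⟨C, hC⟩ := η.hasCompactSupport.exists_bound_of_continuous η.continuous
  exact .of_bound (η.continuous.comp continuous_subtype_val).aestronglyMeasurable C
    (.of_forall fun x => hC x)

/-- Test fields as elements of `L²(ν)`. -/
def testFunctionToL2 (ν : Measure Ω) [IsFiniteMeasure ν] :
    𝓓(⟨Ω, hΩ⟩, Eu m) →ₗ[ℝ] Lp (Eu m) 2 ν where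
  toFun η := (memLp_testFunction ν η).toLp
  map_add' η χ := MemLp.toLp_add (memLp_testFunction ν η) (memLp_testFunction ν χ)
  map_smul' c η := MemLp.toLp_const_smul c (memLp_testFunction ν η)

lemma norm_testFunctionToL2 (ν : Measure Ω) [IsFiniteMeasure ν] (η : 𝓓(⟨Ω, hΩ⟩, Eu m)) :
    ‖testFunctionToL2 ν η‖ = (eLpNorm (fun x : Ω => η x) 2 ν).toReal :=
  Lp.norm_toLp _ (memLp_testFunction ν η)

lemma exists_divPairing_eq_integral_inner (hw : IntegrableOn w Ω)
    (ν : Measure Ω) [IsFiniteMeasure ν] {C : ℝ} (hC0 : 0 ≤ C)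
    (hC : ∀ η : 𝓓(⟨Ω, hΩ⟩, Eu m), |divPairing hw η| ≤ C * ∫ x : Ω, ‖η x‖ ∂ν) :
    ∃ v : Ω → Eu m, Integrable v ν ∧
      ∀ η : 𝓓(⟨Ω, hΩ⟩, Eu m), divPairing hw η = ∫ x : Ω, inner ℝ (v x) (η x) ∂ν := by
  obtain ⟨v, hv⟩ := exists_inner_eq_of_abs_le (testFunctionToL2 ν) (divPairing hw)
    (D := C * √(ν.real univ)) fun η => by
      rw [norm_testFunctionToL2, mul_assoc]
      exact (hC η).trans (mul_le_mul_of_nonneg_left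
        (integral_norm_le_sqrt_mul_eLpNorm (memLp_testFunction ν η)) hC0)
  refine ⟨v, (Lp.memLp v).integrable (by norm_num), fun η => ?_⟩
  rw [hv, L2.inner_def]
  refine integral_congr_ae ?_
  filter_upwards [(memLp_testFunction ν η).coeFn_toLp] with x hx
  exact congrArg (inner ℝ (v x)) hx

lemma hasGradientMeasure_neg_withDensityᵥ (hw : IntegrableOn w Ω)
    {ν : Measure Ω} [IsFiniteMeasure ν] {v : Ω → Eu m} (hv : Integrable v ν)
    (hvw : ∀ η : 𝓓(⟨Ω, hΩ⟩, Eu m), divPairing hw η = ∫ x : Ω, inner ℝ (v x) (η x) ∂ν) :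
    HasGradientMeasure Ω w (-ν.withDensityᵥ v) := by
  intro ψ hψ hψc hψs
  have hψi (ν' : Measure Ω) [IsFiniteMeasure ν'] : Integrable (fun x : Ω => ψ x) ν' :=
    integrable_coe_of_hasCompactSupport ν' hψ.continuous hψc
  obtain ⟨B, hB⟩ := hψc.exists_bound_of_continuous hψ.continuous
  have hψv : Integrable (fun x : Ω => ψ x • v x) ν :=
    hv.bdd_smul B (hψi ν).aestronglyMeasurable (.of_forall fun x => hB x)
  have hψ1 : ContDiff ℝ 1 ψ := hψ.of_le (by simp)
  rw [VectorMeasure.integral_neg_vectorMeasure, neg_neg, integral_withDensityᵥ hv (hψi _)]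
  refine ext_inner_left ℝ fun e => ?_
  rw [← integral_inner (integrable_smul_gradient hw hψ1 hψc), ← integral_inner hψv]
  have hψe : tsupport (fun x => ψ x • e) ⊆ Ω :=
    (tsupport_smul_subset_left ψ fun _ => e).trans hψs
  have h : ∫ x in Ω, w x * divergence (fun x => ψ x • e) x
      = ∫ x : Ω, inner ℝ (v x) (ψ x • e) ∂ν :=
    hvw ⟨_, hψ.smul contDiff_const, hψc.smul_right, hψe⟩
  simp only [divergence_smul_const (hψ1.differentiable one_ne_zero _)] at h
  simpa only [inner_smul_right, inner_gradient_right, real_inner_comm e] using h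

theorem exists_hasGradientMeasure (hΩ : IsOpen Ω) (hw : IntegrableOn w Ω) (ν : Measure Ω)
    [IsFiniteMeasure ν] {C : ℝ} (hC0 : 0 ≤ C) (hC : ∀ η : 𝓓(⟨Ω, hΩ⟩, Eu m),
      |∫ x in Ω, w x * divergence η x| ≤ C * ∫ x : Ω, ‖η x‖ ∂ν) :
    ∃ μ : VectorMeasure Ω (Eu m), HasGradientMeasure Ω w μ := by
  obtain ⟨v, hv, hvw⟩ := exists_divPairing_eq_integral_inner hw ν hC0 hC
  exact ⟨_, hasGradientMeasure_neg_withDensityᵥ hw hv hvw⟩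

end gradientMeasure

/-! ### Lipschitz transformations and the Piola identity -/

lemma jacobian_eq_abs_det (γ : PartialEquiv (Eu m) (Eu m)) (x : Eu m) :
    jacobian γ x = |(fderiv ℝ γ x).det| := by
  have h := ContinuousLinearMap.normDet_sq (𝕜 := ℝ) (fderiv ℝ γ x)
  have h1 : (fderiv ℝ γ x : Eu m →ₗ[ℝ] Eu m).normDet = |(fderiv ℝ γ x).det| :=
    LinearMap.normDet_eq_abs_det _
  have h2 : (ContinuousLinearMap.adjoint (fderiv ℝ γ x) ∘L fderiv ℝ γ x).det
      = |(fderiv ℝ γ x).det| ^ 2 := by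
    rw [← h1]
    exact h.symm
  rw [jacobian, h2, Real.sqrt_sq (abs_nonneg _)]

lemma jacobian_nonneg (γ : PartialEquiv (Eu m) (Eu m)) (x : Eu m) : 0 ≤ jacobian γ x :=
  Real.sqrt_nonneg _

lemma measurable_jacobian (γ : PartialEquiv (Eu m) (Eu m)) : Measurable (jacobian γ) := by
  have h : jacobian γ = fun x => |(fderiv ℝ γ x).det| := funext (jacobian_eq_abs_det γ)
  rw [h]
  exact (ContinuousLinearMap.continuous_det.abs.measurable).comp (measurable_fderiv ℝ γ)

lemma adjoint_lipJac (γ : PartialEquiv (Eu m) (Eu m)) (x : Eu m) :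
    ContinuousLinearMap.adjoint (lipJac γ x) = jacobian γ x • fderiv ℝ γ.symm (γ x) := by
  simp [lipJac, invGrad]

namespace IsLipTransform

variable {Ω U : Set (Eu m)} {γ : PartialEquiv (Eu m) (Eu m)}

lemma symm (hγ : IsLipTransform Ω U γ) : IsLipTransform Ω U γ.symm where
  source_eq := hγ.target_eq
  target_eq := hγ.source_eq
  lipschitz := hγ.lipschitz_symm
  lipschitz_symm := by simpa using hγ.lipschitz
  lusin := hγ.lusin_symm
  lusin_symm := by simpa using hγ.lusin
  eq_self x hx := by
    have h := γ.left_inv (hγ.source_eq ▸ hx.1)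
    rwa [hγ.eq_self x hx] at h

variable (hγ : IsLipTransform Ω U γ)

include hγ

lemma mapsTo : MapsTo γ Ω Ω := fun x hx => by
  have h := γ.map_source (hγ.source_eq ▸ hx)
  rwa [hγ.target_eq] at h

lemma left_inv {x : Eu m} (hx : x ∈ Ω) : γ.symm (γ x) = x := γ.left_inv (hγ.source_eq ▸ hx)

lemma right_inv {x : Eu m} (hx : x ∈ Ω) : γ (γ.symm x) = x := γ.right_inv (hγ.target_eq ▸ hx)

lemma injOn : InjOn γ Ω := fun x hx y hy h => by
  rw [← hγ.left_inv hx, h, hγ.left_inv hy]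

lemma continuousOn : ContinuousOn γ Ω := hγ.lipschitz.choose_spec.continuousOn

lemma image_eq {A : Set (Eu m)} (hA : A ⊆ Ω) : γ '' A = Ω ∩ γ.symm ⁻¹' A := by
  ext y
  constructor
  · rintro ⟨x, hx, rfl⟩
    refine ⟨hγ.mapsTo (hA hx), ?_⟩
    rwa [mem_preimage, hγ.left_inv (hA hx)]
  · rintro ⟨hy, hy'⟩
    exact ⟨_, hy', hγ.right_inv hy⟩

lemma image_subset {A : Set (Eu m)} (hA : A ⊆ Ω) : γ '' A ⊆ Ω :=
  (image_mono hA).trans hγ.mapsTo.image_subset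

lemma image_univ : γ '' Ω = Ω := by
  rw [hγ.image_eq Subset.rfl]
  exact inter_eq_left.2 hγ.symm.mapsTo

lemma isOpen_image (hΩ : IsOpen Ω) {A : Set (Eu m)} (hAo : IsOpen A) (hA : A ⊆ Ω) :
    IsOpen (γ '' A) := by
  rw [hγ.image_eq hA]
  exact hγ.symm.continuousOn.isOpen_inter_preimage hΩ hAo

lemma ae_differentiableAt (hΩ : IsOpen Ω) :
    ∀ᵐ x ∂volume.restrict Ω, DifferentiableAt ℝ γ x := by
  obtain ⟨K, hK⟩ := hγ.lipschitz
  filter_upwards [hK.ae_differentiableWithinAt (μ := volume) hΩ.measurableSet,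
    ae_restrict_mem hΩ.measurableSet] with x hx hxΩ
  exact hx.differentiableAt (hΩ.mem_nhds hxΩ)

lemma exists_norm_fderiv_le (hΩ : IsOpen Ω) : ∃ C : ℝ, 0 ≤ C ∧ ∀ x ∈ Ω, ‖fderiv ℝ γ x‖ ≤ C := by
  obtain ⟨K, hK⟩ := hγ.lipschitz
  exact ⟨K, K.2, fun x hx => norm_fderiv_le_of_lipschitzOn ℝ (hΩ.mem_nhds hx) hK⟩

lemma exists_jacobian_le (hΩ : IsOpen Ω) : ∃ C : ℝ, 0 ≤ C ∧ ∀ x ∈ Ω, jacobian γ x ≤ C := by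
  obtain ⟨C, -, hC⟩ := hγ.exists_norm_fderiv_le hΩ
  obtain ⟨D, hD⟩ := (isCompact_closedBall (0 : Eu m →L[ℝ] Eu m) C).exists_bound_of_continuousOn
    ContinuousLinearMap.continuous_det.continuousOn
  refine ⟨max D 0, le_max_right _ _, fun x hx => ?_⟩
  rw [jacobian_eq_abs_det]
  exact (hD _ (by simpa using hC x hx)).trans (le_max_left _ _)

lemma exists_norm_invGrad_le (hΩ : IsOpen Ω) : ∃ C : ℝ, 0 ≤ C ∧ ∀ x ∈ Ω, ‖invGrad γ x‖ ≤ C := by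
  obtain ⟨C, hC0, hC⟩ := hγ.symm.exists_norm_fderiv_le hΩ
  refine ⟨C, hC0, fun x hx => ?_⟩
  rw [invGrad, LinearIsometryEquiv.norm_map]
  exact hC _ (hγ.mapsTo hx)

lemma exists_norm_lipJac_le (hΩ : IsOpen Ω) : ∃ C : ℝ, 0 ≤ C ∧ ∀ x ∈ Ω, ‖lipJac γ x‖ ≤ C := by
  obtain ⟨C, hC0, hC⟩ := hγ.exists_norm_invGrad_le hΩ
  obtain ⟨D, hD0, hD⟩ := hγ.exists_jacobian_le hΩ
  refine ⟨D * C, by positivity, fun x hx => ?_⟩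
  rw [lipJac, norm_smul, Real.norm_of_nonneg (jacobian_nonneg γ x)]
  exact mul_le_mul (hD x hx) (hC x hx) (norm_nonneg _) hD0

lemma aemeasurable (hΩ : IsOpen Ω) : AEMeasurable γ (volume.restrict Ω) :=
  hγ.continuousOn.aemeasurable hΩ.measurableSet

lemma ae_comp (hΩ : IsOpen Ω) {P : Eu m → Prop} (h : ∀ᵐ y ∂volume.restrict Ω, P y) :
    ∀ᵐ x ∂volume.restrict Ω, P (γ x) := by
  rw [ae_restrict_iff' hΩ.measurableSet, ae_iff] at h ⊢
  have h0 : volume (γ.symm '' {a | ¬(a ∈ Ω → P a)}) = 0 :=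
    hγ.lusin_symm _ (fun a ha => by
      by_contra h'
      exact ha fun h'' => absurd h'' h') h
  refine measure_mono_null (fun x hx => ?_) h0
  simp only [mem_ofPred_eq, Classical.not_imp] at hx
  exact ⟨γ x, fun h' => hx.2 (h' (hγ.mapsTo hx.1)), hγ.left_inv hx.1⟩

lemma exists_regular_set (hΩ : IsOpen Ω) : ∃ s ⊆ Ω, MeasurableSet s ∧
    (∀ x ∈ s, HasFDerivWithinAt γ (fderiv ℝ γ x) s x) ∧
    s =ᵐ[volume] Ω ∧ γ '' s =ᵐ[volume] Ω := by
  refine ⟨Ω ∩ {x | DifferentiableAt ℝ γ x}, inter_subset_left,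
    hΩ.measurableSet.inter (measurableSet_of_differentiableAt ℝ γ), fun x hx =>
      (DifferentiableAt.hasFDerivAt hx.2).hasFDerivWithinAt, ?_, ?_⟩
  · have h := hγ.ae_differentiableAt hΩ
    rw [ae_restrict_iff' hΩ.measurableSet] at h
    filter_upwards [h] with x hx
    exact propext ⟨fun h => h.1, fun h => ⟨h, hx h⟩⟩
  · have h := hγ.symm.ae_comp hΩ (hγ.ae_differentiableAt hΩ)
    rw [ae_restrict_iff' hΩ.measurableSet] at h
    rw [hγ.image_eq inter_subset_left]
    filter_upwards [h] with x hx
    exact propext ⟨fun h => h.1, fun h => ⟨h, hγ.symm.mapsTo h, hx h⟩⟩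

lemma integral_comp (hΩ : IsOpen Ω) (F : Eu m → ℝ) :
    ∫ y in Ω, F y = ∫ x in Ω, jacobian γ x * F (γ x) := by
  obtain ⟨s, hsΩ, hs, hd, hs1, hs2⟩ := hγ.exists_regular_set hΩ
  rw [← setIntegral_congr_set hs2, ← setIntegral_congr_set hs1,
    integral_image_eq_integral_abs_det_fderiv_smul volume hs hd (hγ.injOn.mono hsΩ)]
  simp only [jacobian_eq_abs_det, smul_eq_mul]

lemma integrableOn_pushforward (hΩ : IsOpen Ω) {u : Eu m → ℝ} (hu : IntegrableOn u Ω) :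
    IntegrableOn (pushforward γ u) Ω := by
  obtain ⟨s, hsΩ, hs, hd, -, hs2⟩ := hγ.exists_regular_set hΩ
  obtain ⟨C, -, hC⟩ := hγ.exists_jacobian_le hΩ
  rw [← integrableOn_congr_set_ae hs2,
    integrableOn_image_iff_integrableOn_abs_det_fderiv_smul volume hs hd (hγ.injOn.mono hsΩ)]
  have h : IntegrableOn (fun x => jacobian γ x * u x) s := by
    refine (hu.mono_set hsΩ).bdd_mul (c := C) (measurable_jacobian γ).aestronglyMeasurable ?_
    filter_upwards [ae_restrict_mem hs] with x hx
    rw [Real.norm_of_nonneg (jacobian_nonneg γ x)]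
    exact hC x (hsΩ hx)
  refine h.congr_fun (fun x hx => ?_) hs
  simp [pushforward, hγ.left_inv (hsΩ hx), jacobian_eq_abs_det]

lemma aestronglyMeasurable_lipJac (hΩ : IsOpen Ω) :
    AEStronglyMeasurable (lipJac γ) (volume.restrict Ω) := by
  have h1 : AEMeasurable (fun x => fderiv ℝ γ.symm (γ x)) (volume.restrict Ω) :=
    (measurable_fderiv ℝ γ.symm).comp_aemeasurable (hγ.aemeasurable hΩ)
  exact (measurable_jacobian γ).aestronglyMeasurable.smul
    (ContinuousLinearMap.adjoint.continuous.comp_aestronglyMeasurable h1.aestronglyMeasurable)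

end IsLipTransform

/-- The pull-back `L_γ(x)* φ(γ(x))` of a vector field under a transformation `γ` of `Ω`, with
`L_γ = lipJac γ`, extended by zero. -/
def pullField (Ω : Set (Eu m)) (γ : PartialEquiv (Eu m) (Eu m)) (φ : Eu m → Eu m) :
    Eu m → Eu m :=
  Ω.indicator fun x => ContinuousLinearMap.adjoint (lipJac γ x) (φ (γ x))

/-- The function `J γ(x) (div φ)(γ(x))` on `Ω`, extended by zero.  By the Piola identity it is the
divergence of the pull-back of `φ`. -/
def pullDiv (Ω : Set (Eu m)) (γ : PartialEquiv (Eu m) (Eu m)) (φ : Eu m → Eu m) : Eu m → ℝ :=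
  Ω.indicator fun x => jacobian γ x * divergence φ (γ x)

lemma pullField_eq_zero {Ω : Set (Eu m)} {γ : PartialEquiv (Eu m) (Eu m)} {φ : Eu m → Eu m}
    {x : Eu m} (h : x ∈ Ω → γ x ∉ tsupport φ) : pullField Ω γ φ x = 0 := by
  refine indicator_apply_eq_zero.2 fun hx => ?_
  rw [image_eq_zero_of_notMem_tsupport (h hx), map_zero]

lemma pullDiv_eq_zero {Ω : Set (Eu m)} {γ : PartialEquiv (Eu m) (Eu m)} {φ : Eu m → Eu m}
    {x : Eu m} (h : x ∈ Ω → γ x ∉ tsupport φ) : pullDiv Ω γ φ x = 0 := by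
  refine indicator_apply_eq_zero.2 fun hx => ?_
  rw [divergence_eq_zero (h hx), mul_zero]

lemma integrable_of_bounded_of_forall_notMem_eq_zero {X F : Type*} [MeasurableSpace X]
    [NormedAddCommGroup F] {μ : Measure X} {f : X → F} {s : Set X} (hs : μ s ≠ ⊤)
    (hf : AEStronglyMeasurable f μ) {C : ℝ} (hC : ∀ x, ‖f x‖ ≤ C) (h0 : ∀ x ∉ s, f x = 0) :
    Integrable f μ :=
  (integrableOn_iff_integrable_of_support_subset fun x hx => not_imp_comm.1 (h0 x) hx).1
    (Measure.integrableOn_of_bounded hs hf (.of_forall hC))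

namespace IsLipTransform

variable {Ω U : Set (Eu m)} {γ : PartialEquiv (Eu m) (Eu m)} {φ : Eu m → Eu m}
  (hγ : IsLipTransform Ω U γ)

include hγ

lemma exists_norm_pullDiv_le (hΩ : IsOpen Ω) (hφ : ContDiff ℝ 1 φ) (hc : HasCompactSupport φ) :
    ∃ M, ∀ x, ‖pullDiv Ω γ φ x‖ ≤ M := by
  obtain ⟨C, hC0, hC⟩ := hγ.exists_jacobian_le hΩ
  obtain ⟨D, hD⟩ := exists_bound_divergence hφ hc
  have hD0 : 0 ≤ D := (norm_nonneg _).trans (hD 0)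
  refine ⟨C * D, fun x => ?_⟩
  by_cases hx : x ∈ Ω
  · rw [pullDiv, indicator_of_mem hx, norm_mul, Real.norm_of_nonneg (jacobian_nonneg γ x)]
    exact mul_le_mul (hC x hx) (hD _) (norm_nonneg _) hC0
  · rw [pullDiv, indicator_of_notMem hx, norm_zero]
    positivity

lemma exists_norm_pullField_le (hΩ : IsOpen Ω) :
    ∃ C : ℝ, 0 ≤ C ∧ ∀ (φ : Eu m → Eu m) (x : Eu m),
      ‖pullField Ω γ φ x‖ ≤ C * Ω.indicator (fun x => ‖φ (γ x)‖) x := by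
  obtain ⟨C, hC0, hC⟩ := hγ.exists_norm_lipJac_le hΩ
  refine ⟨C, hC0, fun φ x => ?_⟩
  by_cases hx : x ∈ Ω
  · rw [pullField, indicator_of_mem hx, indicator_of_mem hx]
    refine (ContinuousLinearMap.le_opNorm _ _).trans ?_
    rw [LinearIsometryEquiv.norm_map]
    exact mul_le_mul_of_nonneg_right (hC x hx) (norm_nonneg _)
  · simp [pullField, hx]

lemma aestronglyMeasurable_pullDiv (hΩ : IsOpen Ω) (hφ : ContDiff ℝ 1 φ) :
    AEStronglyMeasurable (pullDiv Ω γ φ) :=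
  (aestronglyMeasurable_indicator_iff hΩ.measurableSet).2 <|
    (measurable_jacobian γ).aestronglyMeasurable.mul
      ((continuous_divergence hφ).measurable.comp_aemeasurable
        (hγ.aemeasurable hΩ)).aestronglyMeasurable

lemma aestronglyMeasurable_pullField (hΩ : IsOpen Ω) (hφ : Continuous φ) :
    AEStronglyMeasurable (pullField Ω γ φ) := by
  have hadj : AEStronglyMeasurable (fun x => ContinuousLinearMap.adjoint (lipJac γ x))
      (volume.restrict Ω) :=
    ContinuousLinearMap.adjoint.continuous.comp_aestronglyMeasurable
      (hγ.aestronglyMeasurable_lipJac hΩ)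
  exact (aestronglyMeasurable_indicator_iff hΩ.measurableSet).2 <|
    (ContinuousLinearMap.id ℝ (Eu m →L[ℝ] Eu m)).aestronglyMeasurable_comp₂ hadj
      (hφ.measurable.comp_aemeasurable (hγ.aemeasurable hΩ)).aestronglyMeasurable

lemma integral_pushforward_mul_divergence (hΩ : IsOpen Ω) (u : Eu m → ℝ) (φ : Eu m → Eu m) :
    ∫ y in Ω, pushforward γ u y * divergence φ y = ∫ x in Ω, u x * pullDiv Ω γ φ x := by
  rw [hγ.integral_comp hΩ]
  refine setIntegral_congr_fun hΩ.measurableSet fun x hx => ?_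
  simp only [pushforward, Function.comp_apply, hγ.left_inv hx, pullDiv, indicator_of_mem hx]
  ring

lemma ae_fderiv_eq_comp_of_eqOn_pushforward (hΩ : IsOpen Ω) {ψ g : Eu m → ℝ}
    (hψ : Differentiable ℝ ψ) (hg : EqOn g (pushforward γ ψ) Ω) :
    ∀ᵐ x ∂volume.restrict Ω, fderiv ℝ g (γ x) = fderiv ℝ ψ x ∘L fderiv ℝ γ.symm (γ x) := by
  filter_upwards [hγ.ae_comp hΩ (hγ.symm.ae_differentiableAt hΩ),
    ae_restrict_mem hΩ.measurableSet] with x hx hxΩ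
  have hψx : HasFDerivAt ψ (fderiv ℝ ψ x) (γ.symm (γ x)) := by
    rw [hγ.left_inv hxΩ]
    exact (hψ x).hasFDerivAt
  refine ((hψx.comp (γ x) hx.hasFDerivAt).congr_of_eventuallyEq ?_).fderiv
  filter_upwards [hΩ.mem_nhds (hγ.mapsTo hxΩ)] with y hy using hg hy

lemma hasWeakDiv_pull (hΩ : IsOpen Ω) (hφ : ContDiff ℝ 1 φ) (hc : HasCompactSupport φ)
    (hs : tsupport φ ⊆ Ω) : HasWeakDiv (pullField Ω γ φ) (pullDiv Ω γ φ) := by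
  intro ψ hψ hψc
  obtain ⟨K, hK⟩ := ContDiff.lipschitzWith_of_hasCompactSupport hψc hψ (by simp)
  obtain ⟨L, hL⟩ := hγ.lipschitz_symm
  -- `ψ ∘ γ⁻¹` is only defined on `Ω`; a global Lipschitz extension has the same integrals there.
  obtain ⟨g, hg, hge⟩ := (hK.comp_lipschitzOnWith hL).extend_real
  have hφ0 : ∀ y ∉ Ω, y ∉ tsupport φ := fun y hy h => hy (hs h)
  have hchange : ∫ y in Ω, fderiv ℝ g y (φ y) = ∫ x in Ω, fderiv ℝ ψ x (pullField Ω γ φ x) := by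
    rw [hγ.integral_comp hΩ]
    refine integral_congr_ae ?_
    filter_upwards [hγ.ae_fderiv_eq_comp_of_eqOn_pushforward hΩ (hψ.differentiable (by simp))
      hge.symm, ae_restrict_mem hΩ.measurableSet] with x hx hxΩ
    rw [hx, pullField, indicator_of_mem hxΩ, adjoint_lipJac]
    simp
  calc ∫ x, ψ x * pullDiv Ω γ φ x = ∫ x in Ω, ψ x * pullDiv Ω γ φ x :=
        (setIntegral_eq_integral_of_forall_compl_eq_zero fun x hx => by
          rw [pullDiv_eq_zero fun h => absurd h hx, mul_zero]).symm
    _ = ∫ y in Ω, g y * divergence φ y := by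
        rw [← hγ.integral_pushforward_mul_divergence hΩ]
        exact setIntegral_congr_fun hΩ.measurableSet fun y hy => by simp only [← hge hy]; rfl
    _ = ∫ y, g y * divergence φ y :=
        setIntegral_eq_integral_of_forall_compl_eq_zero fun y hy => by
          rw [divergence_eq_zero (hφ0 y hy), mul_zero]
    _ = -∫ y, fderiv ℝ g y (φ y) := integral_mul_divergence_eq_neg hg hφ hc
    _ = -∫ y in Ω, fderiv ℝ g y (φ y) := by
        rw [setIntegral_eq_integral_of_forall_compl_eq_zero fun y hy => by
          rw [image_eq_zero_of_notMem_tsupport (hφ0 y hy), map_zero]]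
    _ = -∫ x, fderiv ℝ ψ x (pullField Ω γ φ x) := by
        rw [hchange, setIntegral_eq_integral_of_forall_compl_eq_zero fun x hx => by
          rw [pullField_eq_zero fun h => absurd h hx, map_zero]]

lemma isWeakTestField_pull (hΩ : IsOpen Ω) {A : Set (Eu m)} (hA : A ⊆ Ω) (hφ : ContDiff ℝ 1 φ)
    (hc : HasCompactSupport φ) (hs : tsupport φ ⊆ γ '' A) :
    IsWeakTestField A (pullField Ω γ φ) (pullDiv Ω γ φ) := by
  have hsΩ : tsupport φ ⊆ Ω := hs.trans (hγ.image_subset hA)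
  have hK : IsCompact (γ.symm '' tsupport φ) :=
    IsCompact.image_of_continuousOn hc (hγ.symm.continuousOn.mono hsΩ)
  have hKA : γ.symm '' tsupport φ ⊆ A := by
    rintro _ ⟨_, hy, rfl⟩
    obtain ⟨x, hx, rfl⟩ := hs hy
    rwa [hγ.left_inv (hA hx)]
  have hKφ : ∀ x ∉ γ.symm '' tsupport φ, x ∈ Ω → γ x ∉ tsupport φ :=
    fun x hx hxΩ h => hx ⟨γ x, h, hγ.left_inv hxΩ⟩
  obtain ⟨C, hC0, hC⟩ := hγ.exists_norm_pullField_le hΩ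
  obtain ⟨B, hB⟩ := hc.exists_bound_of_continuous hφ.continuous
  have hpull (x : Eu m) : ‖pullField Ω γ φ x‖ ≤ C * B :=
    (hC φ x).trans <| mul_le_mul_of_nonneg_left
      (indicator_le' (fun _ _ => hB _) (fun _ _ => (norm_nonneg _).trans (hB 0)) x) hC0
  obtain ⟨M, hM⟩ := hγ.exists_norm_pullDiv_le hΩ hφ hc
  exact
  { integrable := integrable_of_bounded_of_forall_notMem_eq_zero hK.measure_ne_top
      (hγ.aestronglyMeasurable_pullField hΩ hφ.continuous) hpull
      fun x hx => pullField_eq_zero (hKφ x hx)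
    integrable_div := integrable_of_bounded_of_forall_notMem_eq_zero hK.measure_ne_top
      (hγ.aestronglyMeasurable_pullDiv hΩ hφ) hM fun x hx => pullDiv_eq_zero (hKφ x hx)
    bounded_div := ⟨M, hM⟩
    exists_isCompact := ⟨_, hKA, hK, fun x hx =>
      ⟨pullField_eq_zero (hKφ x hx), pullDiv_eq_zero (hKφ x hx)⟩⟩
    hasWeakDiv := hγ.hasWeakDiv_pull hΩ hφ hc hsΩ }

lemma setIntegral_pushforward_mul_divergence (hΩ : IsOpen Ω) {A : Set (Eu m)} (hA : A ⊆ Ω)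
    (hφ : ContDiff ℝ 1 φ) (hc : HasCompactSupport φ) (hs : tsupport φ ⊆ γ '' A) (u : Eu m → ℝ) :
    ∫ y in γ '' A, pushforward γ u y * divergence φ y = ∫ x in A, u x * pullDiv Ω γ φ x := by
  rw [setIntegral_mul_divergence_eq hΩ.measurableSet (hγ.image_subset hA) _ hs,
    hγ.integral_pushforward_mul_divergence hΩ,
    (hγ.isWeakTestField_pull hΩ hA hφ hc hs).setIntegral_eq hΩ.measurableSet hA]

end IsLipTransform

/-! ### Comparison of total variations under two transformations -/

lemma le_essSup_of_forall_le {X : Type*} [MeasurableSpace X] {ν : Measure X} {f : X → ℝ} {c : ℝ}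
    (hc : c ≤ 0) (h : ∀ x, c ≤ f x) : c ≤ essSup f ν := by
  rw [essSup, limsup_eq]
  rcases (ae ν).eq_or_neBot with hν | hν
  · simpa [hν] using hc
  · refine Real.le_sInf (fun a ha => ?_) hc
    obtain ⟨x, hx⟩ := (show ∀ᵐ x ∂ν, f x ≤ a from ha).exists
    exact (h x).trans hx

section sphereExcess

variable {E F : Type*} [NormedAddCommGroup E] [NormedSpace ℝ E] [NormedAddCommGroup F]
  [NormedSpace ℝ F]

/-- The inner supremum `sup_{‖v‖ = 1} (‖L₁ v‖ + ‖L₂ v‖ - 2 ‖v‖)` of `biG`. -/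
def sphereExcess (L₁ L₂ : E →L[ℝ] F) : ℝ :=
  ⨆ v : Metric.sphere (0 : E) 1, (‖L₁ v‖ + ‖L₂ v‖ - 2 * ‖(v : E)‖)

lemma norm_add_norm_sub_le (L₁ L₂ : E →L[ℝ] F) (v : Metric.sphere (0 : E) 1) :
    ‖L₁ v‖ + ‖L₂ v‖ - 2 * ‖(v : E)‖ ≤ ‖L₁‖ + ‖L₂‖ := by
  have hv : ‖(v : E)‖ = 1 := norm_eq_of_mem_sphere v
  linarith [L₁.unit_le_opNorm v hv.le, L₂.unit_le_opNorm v hv.le]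

lemma le_sphereExcess (L₁ L₂ : E →L[ℝ] F) (v : Metric.sphere (0 : E) 1) :
    ‖L₁ v‖ + ‖L₂ v‖ - 2 * ‖(v : E)‖ ≤ sphereExcess L₁ L₂ :=
  le_ciSup (f := fun v : Metric.sphere (0 : E) 1 => ‖L₁ v‖ + ‖L₂ v‖ - 2 * ‖(v : E)‖)
    ⟨_, forall_mem_range.2 (norm_add_norm_sub_le L₁ L₂)⟩ v

lemma sphereExcess_le (L₁ L₂ : E →L[ℝ] F) : sphereExcess L₁ L₂ ≤ ‖L₁‖ + ‖L₂‖ :=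
  Real.iSup_le (norm_add_norm_sub_le L₁ L₂) (by positivity)

lemma neg_two_le_sphereExcess (L₁ L₂ : E →L[ℝ] F) : -2 ≤ sphereExcess L₁ L₂ := by
  rcases isEmpty_or_nonempty (Metric.sphere (0 : E) 1) with _ | ⟨⟨v⟩⟩
  · simp [sphereExcess]
  · have hv : ‖(v : E)‖ = 1 := norm_eq_of_mem_sphere v
    linarith [le_sphereExcess L₁ L₂ v, norm_nonneg (L₁ v), norm_nonneg (L₂ v)]

lemma norm_add_norm_le_sphereExcess (L₁ L₂ : E →L[ℝ] F) (v : E) :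
    ‖L₁ v‖ + ‖L₂ v‖ ≤ (2 + sphereExcess L₁ L₂) * ‖v‖ := by
  rcases eq_or_ne v 0 with rfl | hv
  · simp
  set e : E := NormedSpace.normalize v
  have he : ‖e‖ = 1 := NormedSpace.norm_normalize hv
  have hv' : v = ‖v‖ • e := (NormedSpace.norm_smul_normalize v).symm
  have hunit := le_sphereExcess L₁ L₂ ⟨e, mem_sphere_zero_iff_norm.2 he⟩
  calc ‖L₁ v‖ + ‖L₂ v‖ = (‖L₁ e‖ + ‖L₂ e‖) * ‖v‖ := by
        conv_lhs => rw [hv', map_smul, map_smul, norm_smul, norm_smul, norm_norm]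
        ring
    _ ≤ (2 + sphereExcess L₁ L₂) * ‖v‖ :=
        mul_le_mul_of_nonneg_right (by linarith) (norm_nonneg v)

end sphereExcess

lemma two_add_biG_nonneg (Ω : Set (Eu m)) (γ₁ γ₂ : PartialEquiv (Eu m) (Eu m)) :
    0 ≤ 2 + biG Ω γ₁ γ₂ := by
  have h : -2 ≤ biG Ω γ₁ γ₂ :=
    le_essSup_of_forall_le (by norm_num) fun x => neg_two_le_sphereExcess _ _
  linarith

lemma biG_le_biT (Ω : Set (Eu m)) (γ₁ γ₂ : PartialEquiv (Eu m) (Eu m)) :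
    biG Ω γ₁ γ₂ ≤ biT Ω γ₁ γ₂ := by
  have h : 0 ≤ biJ Ω γ₁ γ₂ := le_essSup_of_forall_le le_rfl fun x => abs_nonneg _
  unfold biT
  nlinarith [sq_nonneg (distId Ω γ₁), sq_nonneg (distId Ω γ₂)]

section

variable {Ω U₁ U₂ : Set (Eu m)} {γ₁ γ₂ : PartialEquiv (Eu m) (Eu m)}

lemma ae_norm_lipJac_add_le (hΩ : IsOpen Ω) (h₁ : IsLipTransform Ω U₁ γ₁)
    (h₂ : IsLipTransform Ω U₂ γ₂) :
    ∀ᵐ x ∂volume.restrict Ω, ∀ v : Eu m,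
      ‖lipJac γ₁ x v‖ + ‖lipJac γ₂ x v‖ ≤ (2 + biG Ω γ₁ γ₂) * ‖v‖ := by
  obtain ⟨C₁, -, hC₁⟩ := h₁.exists_norm_lipJac_le hΩ
  obtain ⟨C₂, -, hC₂⟩ := h₂.exists_norm_lipJac_le hΩ
  have hbdd : IsBoundedUnder (· ≤ ·) (ae (volume.restrict Ω))
      fun x => sphereExcess (lipJac γ₁ x) (lipJac γ₂ x) := by
    refine isBoundedUnder_of_eventually_le (a := C₁ + C₂) ?_
    filter_upwards [ae_restrict_mem hΩ.measurableSet] with x hx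
    exact (sphereExcess_le _ _).trans (add_le_add (hC₁ x hx) (hC₂ x hx))
  filter_upwards [ae_le_essSup hbdd] with x hx v
  have hx' : sphereExcess (lipJac γ₁ x) (lipJac γ₂ x) ≤ biG Ω γ₁ γ₂ := hx
  exact (norm_add_norm_le_sphereExcess _ _ v).trans
    (mul_le_mul_of_nonneg_right (by linarith) (norm_nonneg v))

lemma ae_norm_pullField_add_le (hΩ : IsOpen Ω) (h₁ : IsLipTransform Ω U₁ γ₁)
    (h₂ : IsLipTransform Ω U₂ γ₂) {φ₁ φ₂ : Eu m → Eu m} (hφ₁ : ∀ x, ‖φ₁ x‖ ≤ 1)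
    (hφ₂ : ∀ x, ‖φ₂ x‖ ≤ 1) :
    ∀ᵐ x, ‖(pullField Ω γ₁ φ₁ + pullField Ω γ₂ φ₂) x‖ ≤ 2 + biG Ω γ₁ γ₂ := by
  have hc := two_add_biG_nonneg Ω γ₁ γ₂
  filter_upwards [(ae_restrict_iff' hΩ.measurableSet).1 (ae_norm_lipJac_add_le hΩ h₁ h₂)]
    with x hx
  by_cases hxΩ : x ∈ Ω
  · rw [Pi.add_apply, pullField, pullField, indicator_of_mem hxΩ, indicator_of_mem hxΩ]
    have hpair {γ} {φ : Eu m → Eu m} (hφ : ∀ x, ‖φ x‖ ≤ 1) (v : Eu m) :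
        inner ℝ (ContinuousLinearMap.adjoint (lipJac γ x) (φ (γ x))) v ≤ ‖lipJac γ x v‖ := by
      rw [ContinuousLinearMap.adjoint_inner_left]
      exact (real_inner_le_norm _ _).trans (mul_le_of_le_one_left (norm_nonneg _) (hφ _))
    set w := ContinuousLinearMap.adjoint (lipJac γ₁ x) (φ₁ (γ₁ x)) +
      ContinuousLinearMap.adjoint (lipJac γ₂ x) (φ₂ (γ₂ x)) with hw
    have hww : ‖w‖ * ‖w‖ ≤ (2 + biG Ω γ₁ γ₂) * ‖w‖ := by
      rw [← real_inner_self_eq_norm_mul_norm]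
      nth_rw 1 [hw]
      rw [inner_add_left]
      exact (add_le_add (hpair hφ₁ w) (hpair hφ₂ w)).trans (hx hxΩ w)
    rcases (norm_nonneg w).eq_or_lt with h0 | h0
    · rwa [← h0]
    · exact le_of_mul_le_mul_right hww h0
  · simpa [pullField, hxΩ] using hc

theorem TV_image_add_le (hΩ : IsOpen Ω) (h₁ : IsLipTransform Ω U₁ γ₁)
    (h₂ : IsLipTransform Ω U₂ γ₂) {A : Set (Eu m)} (hA : IsOpen A) (hAΩ : A ⊆ Ω) {u : Eu m → ℝ}
    (hu : IntegrableOn u A) :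
    TV (γ₁ '' A) (pushforward γ₁ u) + TV (γ₂ '' A) (pushforward γ₂ u)
      ≤ ENNReal.ofReal (2 + biG Ω γ₁ γ₂) * TV A u := by
  refine TV_add_TV_le fun φ₁ φ₂ hφ₁ hφ₂ => ?_
  have H₁ := h₁.isWeakTestField_pull hΩ hAΩ hφ₁.contDiff_one hφ₁.hasCompactSupport
    hφ₁.tsupport_subset
  have H₂ := h₂.isWeakTestField_pull hΩ hAΩ hφ₂.contDiff_one hφ₂.hasCompactSupport
    hφ₂.tsupport_subset
  have hsum : (∫ y in γ₁ '' A, pushforward γ₁ u y * divergence φ₁ y)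
      + ∫ y in γ₂ '' A, pushforward γ₂ u y * divergence φ₂ y
      = ∫ x in A, u x * (pullDiv Ω γ₁ φ₁ + pullDiv Ω γ₂ φ₂) x := by
    rw [h₁.setIntegral_pushforward_mul_divergence hΩ hAΩ hφ₁.contDiff_one
        hφ₁.hasCompactSupport hφ₁.tsupport_subset,
      h₂.setIntegral_pushforward_mul_divergence hΩ hAΩ hφ₂.contDiff_one
        hφ₂.hasCompactSupport hφ₂.tsupport_subset,
      ← integral_add (H₁.integrable_mul hu) (H₂.integrable_mul hu)]
    simp only [Pi.add_apply, mul_add]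
  rw [hsum]
  exact (H₁.add H₂).ofReal_integral_le hA
    (ae_norm_pullField_add_le hΩ h₁ h₂ hφ₁.norm_le_one hφ₂.norm_le_one) hu

end

/-! ### Gradient measures of push-forwards -/

namespace IsLipTransform

variable {Ω U : Set (Eu m)} {γ : PartialEquiv (Eu m) (Eu m)} (hγ : IsLipTransform Ω U γ)

include hγ

/-- The restriction of a Lipschitz transformation to `Ω`, as a homeomorphism of the subtype on which
gradient measures live. -/
def homeomorph : Ω ≃ₜ Ω where
  toFun x := ⟨γ x, hγ.mapsTo x.2⟩
  invFun x := ⟨γ.symm x, hγ.symm.mapsTo x.2⟩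
  left_inv x := Subtype.ext (hγ.left_inv x.2)
  right_inv x := Subtype.ext (hγ.right_inv x.2)
  continuous_toFun := (continuousOn_iff_continuous_domRestrict.1 hγ.continuousOn).subtype_mk _
  continuous_invFun :=
    (continuousOn_iff_continuous_domRestrict.1 hγ.symm.continuousOn).subtype_mk _

lemma continuous_indicator_comp (hΩ : IsOpen Ω) {g : Eu m → ℝ} (hg : Continuous g)
    (hc : HasCompactSupport g) (hs : tsupport g ⊆ Ω) : Continuous (Ω.indicator (g ∘ γ)) := by
  have hK : IsCompact (γ.symm '' tsupport g) :=
    IsCompact.image_of_continuousOn hc (hγ.symm.continuousOn.mono hs)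
  refine continuous_iff_continuousAt.2 fun x => ?_
  by_cases hx : x ∈ Ω
  · refine (hg.continuousAt.comp (hγ.continuousOn.continuousAt (hΩ.mem_nhds hx))).congr ?_
    filter_upwards [hΩ.mem_nhds hx] with y hy
    rw [indicator_of_mem hy]
  · have hxK : x ∉ γ.symm '' tsupport g := fun h => hx (hγ.symm.image_subset hs h)
    refine (continuousAt_const (y := (0 : ℝ))).congr ?_
    filter_upwards [hK.isClosed.isOpen_compl.mem_nhds hxK] with y hy
    refine (indicator_apply_eq_zero.2 fun hyΩ => ?_).symm
    exact image_eq_zero_of_notMem_tsupport (f := g) fun h => hy ⟨γ y, h, hγ.left_inv hyΩ⟩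

lemma exists_abs_integral_pushforward_le (hΩ : IsOpen Ω) {u : Eu m → ℝ}
    {μ : VectorMeasure Ω (Eu m)} (hu : IntegrableOn u Ω) (hμ : HasGradientMeasure Ω u μ) :
    ∃ C : ℝ, 0 ≤ C ∧ ∀ φ : Eu m → Eu m, ContDiff ℝ 1 φ → HasCompactSupport φ → tsupport φ ⊆ Ω →
      |∫ x in Ω, pushforward γ u x * divergence φ x| ≤ C * ∫ x : Ω, ‖φ (γ x)‖ ∂μ.variation := by
  obtain ⟨C, hC0, hC⟩ := hγ.exists_norm_pullField_le hΩ
  refine ⟨C, hC0, fun φ hφ hc hs => ?_⟩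
  obtain ⟨B, hB⟩ := hc.exists_bound_of_continuous hφ.continuous
  set g : Eu m → ℝ := fun x => C * Ω.indicator (fun x => ‖φ (γ x)‖) x with hg
  have hg_cont : Continuous g := continuous_const.mul
    (hγ.continuous_indicator_comp hΩ hφ.continuous.norm hc.norm
      ((tsupport_comp_subset norm_zero φ).trans hs))
  have hg_bound (x : Eu m) : ‖g x‖ ≤ C * B := by
    rw [hg, norm_mul, Real.norm_of_nonneg hC0, norm_indicator_eq_indicator_norm]
    simp only [norm_norm]
    exact mul_le_mul_of_nonneg_left
      (indicator_le' (fun _ _ => hB _) (fun _ _ => (norm_nonneg _).trans (hB 0)) x) hC0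
  have hg_int : ∫ x : Ω, g x ∂μ.variation = C * ∫ x : Ω, ‖φ (γ x)‖ ∂μ.variation := by
    simp only [hg, Subtype.coe_prop, indicator_of_mem, integral_const_mul]
  have H := hγ.isWeakTestField_pull hΩ Subset.rfl hφ hc (hγ.image_univ.symm ▸ hs)
  rw [hγ.integral_pushforward_mul_divergence hΩ, ← hg_int]
  exact hμ.abs_integral_mul_le hu hΩ H hg_cont hg_bound (.of_forall (hC φ))

theorem exists_hasGradientMeasure_pushforward (hΩ : IsOpen Ω) {u : Eu m → ℝ}
    {μ : VectorMeasure Ω (Eu m)} (hu : IntegrableOn u Ω) (hμ : HasGradientMeasure Ω u μ) :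
    ∃ D : VectorMeasure Ω (Eu m), HasGradientMeasure Ω (pushforward γ u) D := by
  obtain ⟨C, hC0, hC⟩ := hγ.exists_abs_integral_pushforward_le hΩ hu hμ
  refine exists_hasGradientMeasure hΩ (hγ.integrableOn_pushforward hΩ hu)
    (μ.variation.map hγ.homeomorph) hC0 fun η => ?_
  have hmap : ∫ x : Ω, ‖η x‖ ∂(μ.variation.map hγ.homeomorph)
      = ∫ x : Ω, ‖η (γ x)‖ ∂μ.variation :=
    integral_map hγ.homeomorph.continuous.aemeasurable
      (η.contDiff.continuous.comp continuous_subtype_val).norm.aestronglyMeasurable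
  rw [hmap]
  exact hC η (η.contDiff.of_le (by norm_cast)) η.hasCompactSupport η.tsupport_subset

/-- The pull-back to `Ω` of the total variation measure `|D|` along a Lipschitz transformation. -/
def pullVar (D : VectorMeasure Ω (Eu m)) : Measure Ω := D.variation.map hγ.homeomorph.symm

instance isFiniteMeasure_pullVar (D : VectorMeasure Ω (Eu m)) :
    IsFiniteMeasure (hγ.pullVar D) := by
  unfold pullVar
  infer_instance

lemma pullVar_apply (D : VectorMeasure Ω (Eu m)) {A : Set (Eu m)}
    (hA : MeasurableSet ((↑) ⁻¹' A : Set Ω)) :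
    hγ.pullVar D ((↑) ⁻¹' A) = varOn D (γ '' (A ∩ Ω)) := by
  rw [pullVar, Measure.map_apply hγ.homeomorph.symm.continuous.measurable hA, varOn]
  congr 1
  ext y
  rw [hγ.image_eq inter_subset_right]
  exact ⟨fun h => ⟨y.2, h, hγ.symm.mapsTo y.2⟩, fun h => h.2.1⟩

lemma pullVar_eq_TV (hΩ : IsOpen Ω) {w : Eu m → ℝ} (hw : IntegrableOn w Ω)
    {D : VectorMeasure Ω (Eu m)} (hD : HasGradientMeasure Ω w D) {A : Set (Eu m)} (hA : IsOpen A)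
    (hAΩ : A ⊆ Ω) : hγ.pullVar D ((↑) ⁻¹' A) = TV (γ '' A) w := by
  rw [hγ.pullVar_apply D (hA.preimage continuous_subtype_val).measurableSet,
    inter_eq_left.2 hAΩ,
    hD.varOn_eq_TV hw hΩ (hγ.isOpen_image hΩ hA hAΩ) (hγ.image_subset hAΩ)]

lemma TV_image_eq_of_disjoint {A : Set (Eu m)} (hA : IsOpen A) (hAΩ : A ⊆ Ω)
    (hAU : Disjoint A U) (u : Eu m → ℝ) : TV (γ '' A) (pushforward γ u) = TV A u := by
  have hfix {δ : PartialEquiv (Eu m) (Eu m)} (hδ : IsLipTransform Ω U δ) : EqOn δ id A :=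
    fun x hx => hδ.eq_self x ⟨hAΩ hx, disjoint_left.1 hAU hx⟩
  rw [(hfix hγ).image_eq, image_id]
  refine TV_congr_ae ?_
  filter_upwards [ae_restrict_mem hA.measurableSet] with x hx
  rw [pushforward, Function.comp_apply, hfix hγ.symm hx, id]

end IsLipTransform

/-! ### Comparison of gradient measures -/

lemma measure_le_of_forall_isOpen_le {X : Type*} [TopologicalSpace X] [MeasurableSpace X]
    {κ₁ κ₂ : Measure X} [κ₂.OuterRegular] (h : ∀ O, IsOpen O → κ₁ O ≤ κ₂ O) : κ₁ ≤ κ₂ := by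
  refine Measure.le_intro fun S _ _ => ?_
  rw [S.measure_eq_iInf_isOpen κ₂]
  exact le_iInf₂ fun O hO => le_iInf fun hO' => (measure_mono hO).trans (h O hO')

section

variable {Ω U : Set (Eu m)} {γ γ₁ γ₂ : PartialEquiv (Eu m) (Eu m)} {u : Eu m → ℝ}
  {μ D D₁ D₂ : VectorMeasure Ω (Eu m)}

lemma exists_isOpen_preimage_coe_eq (hΩ : IsOpen Ω) {O : Set Ω} (hO : IsOpen O) :
    ∃ A ⊆ Ω, IsOpen A ∧ ((↑) ⁻¹' A : Set Ω) = O :=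
  ⟨(↑) '' O, Subtype.coe_image_subset Ω O, hΩ.isOpenMap_subtype_val O hO,
    preimage_image_eq O Subtype.val_injective⟩

lemma pullVar_restrict_compl_closure_le (hΩ : IsOpen Ω) (hγ : IsLipTransform Ω U γ)
    (hu : IntegrableOn u Ω) (hμ : HasGradientMeasure Ω u μ)
    (hD : HasGradientMeasure Ω (pushforward γ u) D) :
    (hγ.pullVar D).restrict ((↑) ⁻¹' (closure U)ᶜ)
      ≤ μ.variation.restrict ((↑) ⁻¹' (closure U)ᶜ) := by
  have hW : IsOpen ((closure U)ᶜ) := isClosed_closure.isOpen_compl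
  refine measure_le_of_forall_isOpen_le fun O hO => ?_
  obtain ⟨A, hAΩ, hA, rfl⟩ := exists_isOpen_preimage_coe_eq hΩ hO
  have hAW := hA.inter hW
  have hAWΩ : A ∩ (closure U)ᶜ ⊆ Ω := inter_subset_left.trans hAΩ
  have hdisj : Disjoint (A ∩ (closure U)ᶜ) U :=
    disjoint_left.2 fun x hx hxU => hx.2 (subset_closure hxU)
  rw [Measure.restrict_apply hO.measurableSet, Measure.restrict_apply hO.measurableSet,
    ← preimage_inter, hγ.pullVar_eq_TV hΩ (hγ.integrableOn_pushforward hΩ hu) hD hAW hAWΩ,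
    hγ.TV_image_eq_of_disjoint hAW hAWΩ hdisj, ← hμ.varOn_eq_TV hu hΩ hAW hAWΩ, varOn]

lemma pullVar_add_le (hΩ : IsOpen Ω) (h₁ : IsLipTransform Ω U γ₁) (h₂ : IsLipTransform Ω U γ₂)
    (hu : IntegrableOn u Ω) (hμ : HasGradientMeasure Ω u μ)
    (hD₁ : HasGradientMeasure Ω (pushforward γ₁ u) D₁)
    (hD₂ : HasGradientMeasure Ω (pushforward γ₂ u) D₂) :
    h₁.pullVar D₁ + h₂.pullVar D₂ ≤ Real.toNNReal (2 + biG Ω γ₁ γ₂) • μ.variation := by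
  refine measure_le_of_forall_isOpen_le fun O hO => ?_
  obtain ⟨A, hAΩ, hA, rfl⟩ := exists_isOpen_preimage_coe_eq hΩ hO
  rw [Measure.add_apply,
    h₁.pullVar_eq_TV hΩ (h₁.integrableOn_pushforward hΩ hu) hD₁ hA hAΩ,
    h₂.pullVar_eq_TV hΩ (h₂.integrableOn_pushforward hΩ hu) hD₂ hA hAΩ]
  refine (TV_image_add_le hΩ h₁ h₂ hA hAΩ (hu.mono_set hAΩ)).trans_eq ?_
  rw [← hμ.varOn_eq_TV hu hΩ hA hAΩ]
  rfl

/-- Outside `closure U` both push-forwards agree with `u`, so only the part of `S` inside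
`closure U` contributes. -/
lemma pullVar_real_add_sub_le (hΩ : IsOpen Ω) (h₁ : IsLipTransform Ω U γ₁)
    (h₂ : IsLipTransform Ω U γ₂) (hu : IntegrableOn u Ω) (hμ : HasGradientMeasure Ω u μ)
    (hD₁ : HasGradientMeasure Ω (pushforward γ₁ u) D₁)
    (hD₂ : HasGradientMeasure Ω (pushforward γ₂ u) D₂) {S : Set Ω} (hS : MeasurableSet S) :
    (h₁.pullVar D₁).real S + (h₂.pullVar D₂).real S - 2 * μ.variation.real S
      ≤ biT Ω γ₁ γ₂ * μ.variation.real (S ∩ (↑) ⁻¹' closure U) := by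
  set F : Set Ω := (↑) ⁻¹' closure U
  have hF : MeasurableSet F := (isClosed_closure.preimage continuous_subtype_val).measurableSet
  have houtside {γ D} (hγ : IsLipTransform Ω U γ)
      (hD : HasGradientMeasure Ω (pushforward γ u) D) :
      (hγ.pullVar D).real (S \ F) ≤ μ.variation.real (S \ F) := by
    have h := pullVar_restrict_compl_closure_le hΩ hγ hu hμ hD S
    rw [Measure.restrict_apply hS, Measure.restrict_apply hS] at h
    exact ENNReal.toReal_mono (measure_ne_top _ _) h
  have hinside : (h₁.pullVar D₁).real (S ∩ F) + (h₂.pullVar D₂).real (S ∩ F)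
      ≤ (2 + biG Ω γ₁ γ₂) * μ.variation.real (S ∩ F) := by
    have h := ENNReal.toReal_mono (measure_ne_top _ _)
      (pullVar_add_le hΩ h₁ h₂ hu hμ hD₁ hD₂ (S ∩ F))
    rwa [Measure.add_apply, ENNReal.toReal_add (measure_ne_top _ _) (measure_ne_top _ _),
      Measure.smul_apply, ENNReal.smul_def, smul_eq_mul, ENNReal.toReal_mul,
      ENNReal.coe_toReal, Real.coe_toNNReal _ (two_add_biG_nonneg Ω γ₁ γ₂)] at h
  have hsplit (ν : Measure Ω) [IsFiniteMeasure ν] : ν.real S = ν.real (S ∩ F) + ν.real (S \ F) :=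
    (measureReal_inter_add_sdiff hF).symm
  rw [hsplit (h₁.pullVar D₁), hsplit (h₂.pullVar D₂), hsplit μ.variation]
  have hT := mul_le_mul_of_nonneg_right (biG_le_biT Ω γ₁ γ₂)
    (measureReal_nonneg (μ := μ.variation) (s := S ∩ F))
  linarith [houtside h₁ hD₁, houtside h₂ hD₂]

end

/-! ### Double-Lipschitz comparability -/

lemma coe_ofReal_mul_measure {X : Type*} [MeasurableSpace X] (ν : Measure X) [IsFiniteMeasure ν]
    {α : ℝ} (hα : 0 ≤ α) (S : Set X) :
    ((ENNReal.ofReal α * ν S : ℝ≥0∞) : EReal) = ((α * ν.real S : ℝ) : EReal) := by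
  rw [← EReal.coe_ennreal_toReal (ENNReal.mul_ne_top ENNReal.ofReal_ne_top (measure_ne_top ν S)),
    ENNReal.toReal_mul, ENNReal.toReal_ofReal hα, Measure.real]

lemma TV_pushforward_comparison {Ω U Γ : Set (Eu m)} {γ₁ γ₂ : PartialEquiv (Eu m) (Eu m)}
    {u : Eu m → ℝ} {μ D₁ D₂ : VectorMeasure Ω (Eu m)} {α : ℝ} (hα : 0 ≤ α) (hΩ : IsOpen Ω)
    (h₁ : IsLipTransform Ω U γ₁) (h₂ : IsLipTransform Ω U γ₂) (hu : IntegrableOn u Ω)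
    (hμ : HasGradientMeasure Ω u μ) (hD₁ : HasGradientMeasure Ω (pushforward γ₁ u) D₁)
    (hD₂ : HasGradientMeasure Ω (pushforward γ₂ u) D₂) (hΓ : MeasurableSet Γ) :
    ((ENNReal.ofReal α * TV Ω (pushforward γ₁ u) : ℝ≥0∞) : EReal)
        + (ENNReal.ofReal α * TV Ω (pushforward γ₂ u) : ℝ≥0∞)
        - 2 * (ENNReal.ofReal α * TV Ω u : ℝ≥0∞)
      ≤ (α : EReal) * (biT Ω γ₁ γ₂ : ℝ) * varOn μ (closure U \ Γ)
        + (α : EReal) * ((varOn D₁ (γ₁ '' (Γ ∩ Ω)) : EReal) + varOn D₂ (γ₂ '' (Γ ∩ Ω))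
            - 2 * varOn μ Γ) := by
  have hG : MeasurableSet ((↑) ⁻¹' Γ : Set Ω) := hΓ.preimage measurable_subtype_coe
  have hTV : TV Ω u = μ.variation univ := by
    rw [← hμ.varOn_eq_TV hu hΩ hΩ Subset.rfl, varOn, Subtype.coe_preimage_self]
  have hTVpush {γ D} (hγ : IsLipTransform Ω U γ)
      (hD : HasGradientMeasure Ω (pushforward γ u) D) :
      TV Ω (pushforward γ u) = hγ.pullVar D univ := by
    rw [← Subtype.coe_preimage_self, hγ.pullVar_eq_TV hΩ (hγ.integrableOn_pushforward hΩ hu) hD hΩ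
      Subset.rfl, hγ.image_univ]
  have hcoe (ν : Measure Ω) [IsFiniteMeasure ν] (S : Set Ω) : (ν S : EReal) = (ν.real S : ℝ) :=
    (EReal.coe_ennreal_toReal (measure_ne_top ν S)).symm
  have hsplit (ν : Measure Ω) [IsFiniteMeasure ν] :
      ν.real univ = ν.real ((↑) ⁻¹' Γ) + ν.real ((↑) ⁻¹' Γ)ᶜ :=
    (measureReal_add_measureReal_compl hG).symm
  have hmain := pullVar_real_add_sub_le hΩ h₁ h₂ hu hμ hD₁ hD₂ hG.compl
  rw [inter_comm, ← sdiff_eq, ← preimage_sdiff] at hmain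
  rw [hTVpush h₁ hD₁, hTVpush h₂ hD₂, hTV, coe_ofReal_mul_measure _ hα, coe_ofReal_mul_measure _ hα,
    coe_ofReal_mul_measure _ hα, ← h₁.pullVar_apply D₁ hG, ← h₂.pullVar_apply D₂ hG, varOn, varOn,
    hcoe, hcoe, hcoe, hcoe, hsplit (h₁.pullVar D₁), hsplit (h₂.pullVar D₂), hsplit μ.variation,
    show (2 : EReal) = ((2 : ℝ) : EReal) from rfl]
  simp only [← EReal.coe_mul, ← EReal.coe_add, ← EReal.coe_sub, EReal.coe_le_coe_iff]
  linarith [mul_le_mul_of_nonneg_left hmain hα]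

theorem isDoubleLipschitzComparable_TV {Ω : Set (Eu m)} (hΩ : IsOpen Ω) {α : ℝ} (hα : 0 ≤ α) :
    IsDoubleLipschitzComparable Ω (fun u => ENNReal.ofReal α * TV Ω u) := by
  refine ⟨α, hα, fun u μ hu hμ U _ _ γ₁ γ₂ h₁ h₂ _ => ?_⟩
  obtain ⟨D₁, hD₁⟩ := h₁.exists_hasGradientMeasure_pushforward hΩ hu hμ
  obtain ⟨D₂, hD₂⟩ := h₂.exists_hasGradientMeasure_pushforward hΩ hu hμ
  simpa [varOn] using
    TV_pushforward_comparison hα hΩ h₁ h₂ hu hμ hD₁ hD₂ MeasurableSet.empty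

lemma IsLipschitzGraph.measurableSet {Γ : Set (Eu m)} (h : IsLipschitzGraph Γ) :
    MeasurableSet Γ := by
  obtain ⟨z, hz, V, f, hV, ⟨L, hL⟩, rfl⟩ := h
  borelize (ℝ ∙ z)ᗮ
  refine hV.measurableSet.image_of_continuousOn_injOn
    (continuous_subtype_val.continuousOn.add (hL.continuousOn.smul continuousOn_const))
    fun v _ w _ hvw => ?_
  have hproj (v : (ℝ ∙ z)ᗮ) : inner ℝ z ((v : Eu m) + f v • z) = f v := by
    rw [inner_add_right, Submodule.mem_orthogonal_singleton_iff_inner_right.1 v.2,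
      inner_smul_right, real_inner_self_eq_norm_sq, hz, one_pow, mul_one, zero_add]
  have hf : f v = f w := by rw [← hproj v, ← hproj w]; exact congrArg (inner ℝ z) hvw
  exact Subtype.ext (by simpa [hf] using hvw)

theorem isSeparablyDoubleLipschitzComparable_TV {Ω : Set (Eu m)} (hΩ : IsOpen Ω) {α : ℝ}
    (hα : 0 ≤ α) : IsSeparablyDoubleLipschitzComparable Ω (fun u => ENNReal.ofReal α * TV Ω u) := by
  refine ⟨α, α, hα, hα, fun u μ hu hμ U _ _ γ₁ γ₂ h₁ h₂ _ Γ hΓ => ?_⟩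
  obtain ⟨D₁, hD₁⟩ := h₁.exists_hasGradientMeasure_pushforward hΩ hu hμ
  obtain ⟨D₂, hD₂⟩ := h₂.exists_hasGradientMeasure_pushforward hΩ hu hμ
  exact ⟨D₁, D₂, hD₁, hD₂,
    TV_pushforward_comparison hα hΩ h₁ h₂ hu hμ hD₁ hD₂ hΓ.measurableSet⟩

/-! ### Truncation does not increase the total variation -/

lemma norm_fderiv_comp_le {E : Type*} [NormedAddCommGroup E] [NormedSpace ℝ E] {c : ℝ → ℝ}
    {K : ℝ≥0} (hc : LipschitzWith K c) {w : E → ℝ} {x : E} (hw : DifferentiableAt ℝ w x) :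
    ‖fderiv ℝ (c ∘ w) x‖ ≤ K * ‖fderiv ℝ w x‖ := by
  by_cases hd : DifferentiableAt ℝ (c ∘ w) x
  · have hε : ∀ ε > 0, ‖fderiv ℝ (c ∘ w) x‖ ≤ K * (‖fderiv ℝ w x‖ + ε) := fun ε hε => by
      refine hd.hasFDerivAt.le_of_lip' (by positivity) ?_
      filter_upwards [hw.hasFDerivAt.isLittleO.def hε] with y hy
      calc ‖c (w y) - c (w x)‖ ≤ K * ‖w y - w x‖ := hc.norm_sub_le _ _
        _ ≤ K * (‖fderiv ℝ w x (y - x)‖ + ‖w y - w x - fderiv ℝ w x (y - x)‖) := by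
          gcongr
          exact norm_le_norm_add_norm_sub' _ _
        _ ≤ K * (‖fderiv ℝ w x‖ * ‖y - x‖ + ε * ‖y - x‖) := by
          gcongr
          exact (fderiv ℝ w x).le_opNorm _
        _ = K * (‖fderiv ℝ w x‖ + ε) * ‖y - x‖ := by ring
    have hlim : Tendsto (fun ε => K * (‖fderiv ℝ w x‖ + ε)) (𝓝[>] 0)
        (𝓝 (K * (‖fderiv ℝ w x‖ + 0))) :=
      ((continuous_const.mul (continuous_const.add continuous_id)).tendsto _).mono_left
        nhdsWithin_le_nhds
    rw [← add_zero ‖fderiv ℝ w x‖]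
    exact ge_of_tendsto hlim (eventually_mem_nhdsWithin.mono hε)
  · rw [fderiv_zero_of_not_differentiableAt hd, norm_zero]
    positivity

lemma fderiv_normalize_gradient (w : Eu m → ℝ) (x : Eu m) :
    fderiv ℝ w x (NormedSpace.normalize (∇ w x)) = ‖fderiv ℝ w x‖ := by
  rw [← inner_gradient_right, inner_normalize_self]
  exact (InnerProductSpace.toDual ℝ (Eu m)).symm.norm_map _

lemma integral_fderiv_mollify (k : ℕ) {u : Eu m → ℝ} (hu : Integrable u) {η : Eu m → Eu m}
    (hη : Integrable η) :
    ∫ x, fderiv ℝ (mollify k u) x (η x) = -∫ x, u x * divergence (mollify k η) x := by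
  obtain ⟨L, hL⟩ := exists_lipschitzWith_mollifier (E := Eu m) k
  have hcont : Continuous (fderiv ℝ (mollifier (Eu m) k)) :=
    (contDiff_mollifier k (n := 1)).continuous_fderiv one_ne_zero
  have hint : Integrable
      (fun p : Eu m × Eu m => fderiv ℝ (mollifier (Eu m) k) (p.1 - p.2) (η p.1) * u p.2)
      (volume.prod volume) := by
    refine ((hη.norm.mul_prod hu.norm).const_mul (L : ℝ)).mono' ?_ (.of_forall fun p => ?_)
    · refine AEStronglyMeasurable.mul ?_ hu.aestronglyMeasurable.comp_snd
      exact (ContinuousLinearMap.id ℝ (Eu m →L[ℝ] ℝ)).aestronglyMeasurable_comp₂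
        (hcont.comp (continuous_fst.sub continuous_snd)).aestronglyMeasurable
        hη.aestronglyMeasurable.comp_fst
    · rw [norm_mul, ← mul_assoc]
      gcongr
      exact ContinuousLinearMap.le_of_opNorm_le _ (norm_fderiv_le_of_lipschitz ℝ hL) _
  simp only [fderiv_mollify k hu.locallyIntegrable, divergence_mollify k hη.locallyIntegrable]
  calc ∫ x, (∫ t, (fderiv ℝ (mollifier (Eu m) k) (x - t)).smulRight (u t)) (η x)
      = ∫ x, ∫ t, fderiv ℝ (mollifier (Eu m) k) (x - t) (η x) * u t := by
        congr 1 with x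
        rw [ContinuousLinearMap.integral_apply
          (integrable_fderiv_mollifier_smulRight k hu.locallyIntegrable x)]
        rfl
    _ = ∫ t, ∫ x, fderiv ℝ (mollifier (Eu m) k) (x - t) (η x) * u t := integral_integral_swap hint
    _ = -∫ t, u t * ∫ x, fderiv ℝ (mollifier (Eu m) k) (t - x) (η x) := by
        rw [← integral_neg]
        congr 1 with t
        rw [integral_mul_const, mul_comm, ← mul_neg, ← integral_neg]
        congr 2 with x
        rw [← neg_sub t x, fderiv_mollifier_neg, neg_apply]

lemma integral_norm_fderiv_mollify_le {Ω K : Set (Eu m)} {k : ℕ} {u : Eu m → ℝ}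
    (hΩ : MeasurableSet Ω) (hu : IntegrableOn u Ω) (hK : IsCompact K)
    (hk : Metric.cthickening (1 / (k + 1)) K ⊆ Ω) :
    ENNReal.ofReal (∫ x in K, ‖fderiv ℝ (mollify k (Ω.indicator u)) x‖) ≤ TV Ω u := by
  have hu0 : Integrable (Ω.indicator u) := (integrable_indicator_iff hΩ).2 hu
  set w := mollify k (Ω.indicator u) with hw
  -- Up to the sign, the optimal competitor for `w` on `K`.
  set η : Eu m → Eu m := K.indicator fun x => -NormedSpace.normalize (∇ w x) with hη
  have hgrad : Measurable (∇ w) :=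
    (InnerProductSpace.toDual ℝ (Eu m)).symm.continuous.measurable.comp (measurable_fderiv ℝ w)
  have hη1 (x) : ‖η x‖ ≤ 1 := (norm_indicator_le_norm_self _ x).trans
    (by simpa using norm_normalize_le_one (∇ w x))
  have hη0 : ∀ x ∉ K, η x = 0 := fun x hx => indicator_of_notMem hx _
  have hηi : Integrable η := by
    refine (integrable_indicator_iff hK.measurableSet).2
      (Measure.integrableOn_of_bounded (M := 1) hK.measure_lt_top.ne ?_
        (.of_forall fun x => by simpa using norm_normalize_le_one (∇ w x)))
    exact (hgrad.norm.inv.smul hgrad).neg.aestronglyMeasurable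
  have hpair (x) : fderiv ℝ w x (η x) = -K.indicator (fun x => ‖fderiv ℝ w x‖) x := by
    by_cases hx : x ∈ K
    · simp [hη, hx, fderiv_normalize_gradient]
    · simp [hη, hx]
  have hmass : ∫ x in K, ‖fderiv ℝ w x‖ = ∫ x in Ω, u x * divergence (mollify k η) x := by
    have h := integral_fderiv_mollify k hu0 hηi
    simp only [← hw, hpair, integral_neg, neg_inj, integral_indicator hK.measurableSet] at h
    rw [h, ← integral_indicator hΩ]
    simp only [indicator_mul_left]
  rw [hmass]
  exact le_TV u ⟨contDiff_mollify k hηi.locallyIntegrable, hasCompactSupport_mollify hK hη0,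
    (tsupport_mollify_subset hη0).trans hk, norm_mollify_le_const k (.of_forall hη1)⟩

lemma integral_comp_mul_divergence_le {c : ℝ → ℝ} {K L : ℝ≥0} (hc : LipschitzWith K c)
    {w : Eu m → ℝ} (hw : ContDiff ℝ 1 w) (hL : LipschitzWith L w) {φ : Eu m → Eu m}
    (hφ : ContDiff ℝ 1 φ) (hcs : HasCompactSupport φ) (h1 : ∀ x, ‖φ x‖ ≤ 1) :
    ∫ x, c (w x) * divergence φ x ≤ K * ∫ x in tsupport φ, ‖fderiv ℝ w x‖ := by
  have hT : IsCompact (tsupport φ) := hcs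
  have hint : Integrable ((tsupport φ).indicator fun x => K * ‖fderiv ℝ w x‖) :=
    (integrable_indicator_iff hT.measurableSet).2
      ((continuous_const.mul (hw.continuous_fderiv one_ne_zero).norm).continuousOn
        |>.integrableOn_compact hT)
  calc ∫ x, c (w x) * divergence φ x = -∫ x, fderiv ℝ (c ∘ w) x (φ x) :=
        integral_mul_divergence_eq_neg (hc.comp hL) hφ hcs
    _ ≤ ‖∫ x, fderiv ℝ (c ∘ w) x (φ x)‖ := neg_le_abs _
    _ ≤ ∫ x, (tsupport φ).indicator (fun x => K * ‖fderiv ℝ w x‖) x := by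
        refine norm_integral_le_of_norm_le hint (.of_forall fun x => ?_)
        by_cases hx : x ∈ tsupport φ
        · rw [indicator_of_mem hx]
          exact ((ContinuousLinearMap.le_opNorm _ _).trans
            (mul_le_of_le_one_right (norm_nonneg _) (h1 x))).trans
            (norm_fderiv_comp_le hc (hw.differentiable one_ne_zero x))
        · simp [hx, image_eq_zero_of_notMem_tsupport hx]
    _ = K * ∫ x in tsupport φ, ‖fderiv ℝ w x‖ := by
        rw [integral_indicator hT.measurableSet, integral_const_mul]

lemma tendsto_integral_comp_mollify_mul {c : ℝ → ℝ} (hc : Continuous c) {M : ℝ}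
    (hM : ∀ y, |c y| ≤ M) {u g : Eu m → ℝ} (hu : LocallyIntegrable u) (hg : Integrable g) :
    Tendsto (fun k => ∫ x, c (mollify k u x) * g x) atTop (𝓝 (∫ x, c (u x) * g x)) := by
  refine tendsto_integral_of_dominated_convergence (fun x => M * ‖g x‖) (fun k => ?_)
    (hg.norm.const_mul M) (fun k => .of_forall fun x => ?_) ?_
  · exact (hc.comp (contDiff_mollify k hu (n := 0)).continuous).aestronglyMeasurable.mul
      hg.aestronglyMeasurable
  · rw [norm_mul]
    exact mul_le_mul_of_nonneg_right (hM _) (norm_nonneg _)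
  · filter_upwards [ae_tendsto_mollify hu] with x hx
    exact ((hc.tendsto _).comp hx).mul_const _

theorem TV_comp_le {Ω : Set (Eu m)} (hΩ : IsOpen Ω) {u : Eu m → ℝ} (hu : IntegrableOn u Ω)
    {c : ℝ → ℝ} {K : ℝ≥0} (hc : LipschitzWith K c) {M : ℝ} (hM : ∀ y, |c y| ≤ M) :
    TV Ω (c ∘ u) ≤ K * TV Ω u := by
  refine iSup₂_le fun φ hφ => ?_
  have hu0 : Integrable (Ω.indicator u) := (integrable_indicator_iff hΩ.measurableSet).2 hu
  have hdiv : Integrable (divergence φ) := (continuous_divergence hφ.contDiff_one)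
    |>.integrable_of_hasCompactSupport (hasCompactSupport_divergence hφ.hasCompactSupport)
  have hext : ∫ x in Ω, (c ∘ u) x * divergence φ x
      = ∫ x, c (Ω.indicator u x) * divergence φ x := by
    rw [← integral_indicator hΩ.measurableSet]
    congr 1 with x
    by_cases hx : x ∈ Ω
    · simp [hx]
    · simp [hx, divergence_eq_zero fun h => hx (hφ.tsupport_subset h)]
  rw [hext]
  refine le_of_tendsto ((ENNReal.continuous_ofReal.tendsto _).comp
    (tendsto_integral_comp_mollify_mul hc.continuous hM hu0.locallyIntegrable hdiv)) ?_
  filter_upwards [eventually_cthickening_subset hφ.hasCompactSupport.isCompact hΩ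
    hφ.tsupport_subset] with k hk
  obtain ⟨L, hL⟩ := exists_lipschitzWith_mollify k hu0
  have hsmooth : ContDiff ℝ 1 (mollify k (Ω.indicator u)) :=
    contDiff_mollify k hu0.locallyIntegrable
  calc ENNReal.ofReal (∫ x, c (mollify k (Ω.indicator u) x) * divergence φ x)
      ≤ ENNReal.ofReal (K * ∫ x in tsupport φ, ‖fderiv ℝ (mollify k (Ω.indicator u)) x‖) :=
        ENNReal.ofReal_le_ofReal (integral_comp_mul_divergence_le hc hsmooth hL
          hφ.contDiff_one hφ.hasCompactSupport hφ.norm_le_one)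
    _ = K * ENNReal.ofReal (∫ x in tsupport φ, ‖fderiv ℝ (mollify k (Ω.indicator u)) x‖) := by
        rw [ENNReal.ofReal_mul K.coe_nonneg, ENNReal.ofReal_coe_nnreal]
    _ ≤ K * TV Ω u := by
        gcongr
        exact integral_norm_fderiv_mollify_le hΩ.measurableSet hu hφ.hasCompactSupport.isCompact hk

/-! ### The maximum principle -/

/-- The truncation of `y` to the interval `[-M, M]`, for `0 ≤ M`.  Truncating a candidate at the
supremum of the data can only decrease its energy. -/
def clamp (M y : ℝ) : ℝ := max (-M) (min M y)

lemma lipschitzWith_clamp (M : ℝ) : LipschitzWith 1 (clamp M) :=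
  (LipschitzWith.id.const_min M).const_max (-M)

lemma abs_clamp_le {M : ℝ} (hM : 0 ≤ M) (y : ℝ) : |clamp M y| ≤ M :=
  abs_le.2 ⟨le_max_left _ _, max_le (by linarith) (min_le_left _ _)⟩

lemma clamp_eq_self {M y : ℝ} (hy : |y| ≤ M) : clamp M y = y := by
  obtain ⟨h1, h2⟩ := abs_le.1 hy
  rw [clamp, min_eq_right h2, max_eq_right h1]

lemma abs_sub_clamp_le {M t : ℝ} (ht : |t| ≤ M) (y : ℝ) : |t - clamp M y| ≤ |t - y| := by
  simpa [clamp_eq_self ht] using (lipschitzWith_clamp M).norm_sub_le t y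

lemma abs_clamp_le_abs {M : ℝ} (hM : 0 ≤ M) (y : ℝ) : |clamp M y| ≤ |y| := by
  simpa using abs_sub_clamp_le (t := 0) (by simpa using hM) y

lemma abs_sub_clamp_lt {M t y : ℝ} (ht : |t| ≤ M) (hy : M < |y|) : |t - clamp M y| < |t - y| := by
  obtain ⟨h1, h2⟩ := abs_le.1 ht
  rcases lt_abs.1 hy with h | h
  · rw [clamp, min_eq_left h.le, max_eq_right (by linarith), abs_of_nonpos (by linarith),
      abs_of_nonpos (by linarith)]
    linarith
  · rw [clamp, min_eq_right (by linarith), max_eq_left (by linarith), abs_of_nonneg (by linarith),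
      abs_of_nonneg (by linarith)]
    linarith

lemma integrable_clamp_comp {X : Type*} [MeasurableSpace X] {μ : Measure X} {u : X → ℝ}
    (hu : Integrable u μ) {M : ℝ} (hM : 0 ≤ M) : Integrable (clamp M ∘ u) μ :=
  hu.mono ((lipschitzWith_clamp M).continuous.comp_aestronglyMeasurable hu.aestronglyMeasurable)
    (.of_forall fun _ => abs_clamp_le_abs hM _)

namespace IsPIncreasing

variable {p : ℝ} {φ : ℝ → ℝ≥0∞}

lemma le_of_abs_le (h : IsPIncreasing p φ) {x y : ℝ} (hxy : |x| ≤ |y|) : φ x ≤ φ y := by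
  obtain ⟨C, hC, hφ⟩ := h
  have hneg : C * (|x| - |y|) * |x| ^ (p - 1) ≤ 0 :=
    mul_nonpos_of_nonpos_of_nonneg
      (mul_nonpos_of_nonneg_of_nonpos hC.le (sub_nonpos.2 hxy)) (by positivity)
  have hle := (hφ x y).trans (add_le_add_right (EReal.coe_nonpos.2 hneg) _)
  rwa [add_zero, EReal.coe_ennreal_le_coe_ennreal_iff] at hle

lemma measurable (h : IsPIncreasing p φ) : Measurable φ := by
  have hmono : Monotone fun t => φ (max t 0) := fun s t hst => h.le_of_abs_le <| by
    rw [abs_of_nonneg (le_max_right s 0), abs_of_nonneg (le_max_right t 0)]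
    exact max_le_max_right 0 hst
  have heq : φ = (fun t => φ (max t 0)) ∘ norm := funext fun x => by
    simpa using (h.le_of_abs_le (abs_abs x).ge).antisymm (h.le_of_abs_le (abs_abs x).le)
  exact heq ▸ hmono.measurable.comp measurable_norm

lemma lt_of_abs_lt_of_pos (h : IsPIncreasing p φ) {x y : ℝ} (hx : 0 < |x|) (hxy : |x| < |y|)
    (hy : φ y ≠ ⊤) : φ x < φ y := by
  obtain ⟨C, hC, hφ⟩ := h
  have hneg : C * (|x| - |y|) * |x| ^ (p - 1) < 0 :=
    mul_neg_of_neg_of_pos (mul_neg_of_pos_of_neg hC (sub_neg.2 hxy)) (by positivity)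
  rw [← EReal.coe_ennreal_lt_coe_ennreal_iff]
  refine (hφ x y).trans_lt ?_
  rw [← EReal.coe_ennreal_toReal hy, ← EReal.coe_add, EReal.coe_lt_coe_iff]
  linarith

lemma lt_of_abs_lt (h : IsPIncreasing p φ) {x y : ℝ} (hxy : |x| < |y|) (hy : φ y ≠ ⊤) :
    φ x < φ y := by
  -- The defining inequality is not strict at `x = 0`, so compare through an intermediate point.
  obtain ⟨z, hxz, hzy⟩ := exists_between hxy
  have hz : |z| = z := abs_of_pos ((abs_nonneg x).trans_lt hxz)
  rw [← hz] at hxz hzy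
  exact (h.le_of_abs_le hxz.le).trans_lt
    (h.lt_of_abs_lt_of_pos ((abs_nonneg x).trans_lt hxz) hzy hy)

lemma exists_le_ofReal_mul_abs (h : IsPIncreasing p φ) (h0 : φ 0 = 0) (hp : 1 ≤ p) (M : ℝ) :
    ∃ B : ℝ, ∀ x, |x| ≤ M → φ x ≤ ENNReal.ofReal (B * |x|) := by
  obtain ⟨C, hC, hφ⟩ := h
  refine ⟨C * M ^ (p - 1), fun x hx => ?_⟩
  have hM : 0 ≤ M := (abs_nonneg x).trans hx
  have hle : C * |x| * |x| ^ (p - 1) ≤ C * M ^ (p - 1) * |x| := by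
    rw [mul_right_comm]
    gcongr
  rw [← EReal.coe_ennreal_le_coe_ennreal_iff, EReal.coe_ennreal_ofReal,
    max_eq_left (by positivity)]
  refine le_trans ?_ (EReal.coe_le_coe_iff.2 hle)
  simpa [h0] using hφ x 0

lemma lintegral_comp_ne_top (h : IsPIncreasing p φ) (h0 : φ 0 = 0) (hp : 1 ≤ p) {X : Type*}
    [MeasurableSpace X] {μ : Measure X} {f : X → ℝ} (hf : Integrable f μ) {M : ℝ}
    (hM : ∀ᵐ x ∂μ, |f x| ≤ M) : ∫⁻ x, φ (f x) ∂μ ≠ ⊤ := by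
  obtain ⟨B, hB⟩ := h.exists_le_ofReal_mul_abs h0 hp M
  exact ne_top_of_le_ne_top (hf.abs.const_mul B).lintegral_lt_top.ne
    (lintegral_mono_ae (hM.mono fun x hx => hB _ hx))

end IsPIncreasing

lemma ae_abs_le_toReal_eLpNorm_top {X : Type*} [MeasurableSpace X] {μ : Measure X} {f : X → ℝ}
    (hf : eLpNorm f ⊤ μ ≠ ⊤) : ∀ᵐ x ∂μ, |f x| ≤ (eLpNorm f ⊤ μ).toReal := by
  filter_upwards [ae_le_eLpNormEssSup (f := f) (μ := μ)] with x hx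
  rw [← eLpNorm_exponent_top] at hx
  simpa [toReal_enorm] using ENNReal.toReal_mono hf hx

namespace IsSolution

variable {Ω : Set (Eu m)} {φ : ℝ → ℝ≥0∞} {R : (Eu m → ℝ) → ℝ≥0∞} {f u v : Eu m → ℝ} {p M : ℝ}

lemma energy_ne_top (hu : IsSolution Ω φ R f u) (hf : ∫⁻ x in Ω, φ (f x) ≠ ⊤) (hR : R 0 ≠ ⊤) :
    (∫⁻ x in Ω, φ (f x - u x)) + R u ≠ ⊤ := by
  refine ne_top_of_le_ne_top (ENNReal.add_ne_top.2 ⟨hf, hR⟩) ?_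
  simpa using hu.2 0 integrableOn_zero

lemma lintegral_le_of_le (hu : IsSolution Ω φ R f u) (hv : IntegrableOn v Ω) (hR : R v ≤ R u)
    (hfin : R u ≠ ⊤) : ∫⁻ x in Ω, φ (f x - u x) ≤ ∫⁻ x in Ω, φ (f x - v x) :=
  ENNReal.le_of_add_le_add_right hfin ((hu.2 v hv).trans (add_le_add_right hR _))

lemma ae_abs_le (hu : IsSolution Ω φ R f u) (hp : 1 ≤ p) (h0 : φ 0 = 0) (hφ : IsPIncreasing p φ)
    (hf : IntegrableOn f Ω) (hM : 0 ≤ M) (hfM : ∀ᵐ x ∂volume.restrict Ω, |f x| ≤ M)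
    (hR0 : R 0 ≠ ⊤) (hR : R (clamp M ∘ u) ≤ R u) : ∀ᵐ x ∂volume.restrict Ω, |u x| ≤ M := by
  obtain ⟨hfid, hRu⟩ :=
    ENNReal.add_ne_top.1 (hu.energy_ne_top (hφ.lintegral_comp_ne_top h0 hp hf hfM) hR0)
  have hle : ∀ᵐ x ∂volume.restrict Ω, φ (f x - clamp M (u x)) ≤ φ (f x - u x) :=
    hfM.mono fun x hx => hφ.le_of_abs_le (abs_sub_clamp_le hx _)
  have hmeas : AEMeasurable (fun x => φ (f x - u x)) (volume.restrict Ω) :=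
    hφ.measurable.comp_aemeasurable (hf.aemeasurable.sub hu.1.aemeasurable)
  have heq := ae_eq_of_ae_le_of_lintegral_le hle
    (ne_top_of_le_ne_top hfid (lintegral_mono_ae hle)) hmeas
    (hu.lintegral_le_of_le (integrable_clamp_comp hu.1 hM) hR hRu)
  filter_upwards [heq, hfM, ae_lt_top' hmeas hfid] with x hx hfx hux
  exact not_lt.1 fun hxM => (hφ.lt_of_abs_lt (abs_sub_clamp_lt hfx hxM) hux.ne).ne hx

theorem eLpNorm_top_le (hu : IsSolution Ω φ R f u) (hp : 1 ≤ p) (h0 : φ 0 = 0)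
    (hφ : IsPIncreasing p φ) (hf : IntegrableOn f Ω) (hR0 : R 0 ≠ ⊤)
    (hR : ∀ M, 0 ≤ M → R (clamp M ∘ u) ≤ R u) :
    eLpNorm u ⊤ (volume.restrict Ω) ≤ eLpNorm f ⊤ (volume.restrict Ω) := by
  rcases eq_or_ne (eLpNorm f ⊤ (volume.restrict Ω)) ⊤ with htop | htop
  · rw [htop]
    exact le_top
  have hM : 0 ≤ (eLpNorm f ⊤ (volume.restrict Ω)).toReal := ENNReal.toReal_nonneg
  rw [eLpNorm_exponent_top]
  refine essSup_le_of_ae_le _ ?_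
  filter_upwards [hu.ae_abs_le hp h0 hφ hf hM (ae_abs_le_toReal_eLpNorm_top htop) hR0 (hR _ hM)]
    with x hx
  rw [← ENNReal.ofReal_toReal htop, ← ofReal_norm]
  exact ENNReal.ofReal_le_ofReal hx

end IsSolution

theorem eLpNorm_top_le_of_isSolution_TV {Ω : Set (Eu m)} (hΩ : IsOpen Ω) {a : ℝ≥0∞} {p : ℝ}
    {φ : ℝ → ℝ≥0∞} (hp : 1 ≤ p) (h0 : φ 0 = 0) (hφ : IsPIncreasing p φ) {f u : Eu m → ℝ}
    (hf : IntegrableOn f Ω) (hu : IsSolution Ω φ (fun v => a * TV Ω v) f u) :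
    eLpNorm u ⊤ (volume.restrict Ω) ≤ eLpNorm f ⊤ (volume.restrict Ω) := by
  refine hu.eLpNorm_top_le hp h0 hφ hf (by simp [TV]) fun M hM => ?_
  gcongr
  simpa using TV_comp_le hΩ hu.1 (lipschitzWith_clamp M) (abs_clamp_le hM)

end TVReg

end

theorem proposition4p1_general {m : ℕ} {Ω : Set (TVReg.Eu m)} (hΩ : IsOpen Ω) {α : ℝ}
    (hα : 0 < α) :
    TVReg.IsAdmissible Ω (fun u => ENNReal.ofReal α * TVReg.TV Ω u) ∧
    TVReg.IsDoubleLipschitzComparable Ω (fun u => ENNReal.ofReal α * TVReg.TV Ω u) ∧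
    TVReg.IsSeparablyDoubleLipschitzComparable Ω (fun u => ENNReal.ofReal α * TVReg.TV Ω u) ∧
    ∀ (p : ℝ) (φ : ℝ → ℝ≥0∞), 1 ≤ p → φ 0 = 0 → TVReg.IsPIncreasing p φ →
      ∀ f u : TVReg.Eu m → ℝ, IntegrableOn f Ω →
        TVReg.IsSolution Ω φ (fun u => ENNReal.ofReal α * TVReg.TV Ω u) f u →
        eLpNorm u ⊤ (volume.restrict Ω) ≤ eLpNorm f ⊤ (volume.restrict Ω) :=
  ⟨TVReg.isAdmissible_TV Ω hα, TVReg.isDoubleLipschitzComparable_TV hΩ hα.le,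
    TVReg.isSeparablyDoubleLipschitzComparable_TV hΩ hα.le,
    fun _ _ hp h0 hφ _ _ hf hu => TVReg.eLpNorm_top_le_of_isSolution_TV hΩ hp h0 hφ hf hu⟩

theorem proposition4p1 {m : ℕ} (hm : 2 ≤ m) {Ω : Set (TVReg.Eu m)} (hΩ : IsOpen Ω)
    {α : ℝ} (hα : 0 < α) :
    TVReg.IsAdmissible Ω (fun u => ENNReal.ofReal α * TVReg.TV Ω u) ∧
    TVReg.IsDoubleLipschitzComparable Ω (fun u => ENNReal.ofReal α * TVReg.TV Ω u) ∧
    TVReg.IsSeparablyDoubleLipschitzComparable Ω (fun u => ENNReal.ofReal α * TVReg.TV Ω u) ∧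
    ∀ (p : ℝ) (φ : ℝ → ℝ≥0∞), 1 ≤ p → ConvexOn ℝ≥0 Set.univ φ → LowerSemicontinuous φ →
      φ 0 = 0 → TVReg.IsPIncreasing p φ →
      ∀ f u : TVReg.Eu m → ℝ, IntegrableOn f Ω →
        TVReg.IsSolution Ω φ (fun u => ENNReal.ofReal α * TVReg.TV Ω u) f u →
        eLpNorm u ⊤ (volume.restrict Ω) ≤ eLpNorm f ⊤ (volume.restrict Ω) := by
  obtain ⟨hadm, hdl, hsep, hmax⟩ := proposition4p1_general hΩ hα
  exact ⟨hadm, hdl, hsep, fun p φ hp _ _ h0 hφ => hmax p φ hp h0 hφ⟩
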